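/- **Definitions.** Let $V_1,V_2,V_3$ be complex vector spaces and $T\in V_1\otimes V_2\otimes V_3$. The tensor $T$ is concise if the three contraction maps $V_1^*\to V_2\otimes V_3$, $V_2^*\to V_1\otimes V_3$, $V_3^*\to V_1\otimes V_2$ are injective. For $\varphi\in V_1^*$ let $T(\varphi)\in V_2\otimes V_3$ be the contraction, viewed as a linear map $V_2^*\to V_3$. The second collineation variety $\mathscr{C}^1_2(T)\subseteq\mathbb{P}(\Lambda^2V_2\otimes\Lambda^2V_3)$ is the Zariski closure of the set of points $[\Lambda^2T(\varphi)]$ with $\varphi\in V_1^*$ and $\Lambda^2T(\varphi)\neq0$; in coordinates, it is the closure of the image of the rational map given by the $2\times2$ minors of the matrix of linear forms attached to $T$. We say that $T$ has normal form $N$, where $N$ is a $2\times m$ matrix of linear forms in $x_0,x_1,x_2$, if there are bases $(a_i)_{0\le i\le 2}$ of $V_1$, $(b_j)_{1\le j\le 2}$ of $V_2$ and $(c_k)_{1\le k\le m}$ of $V_3$ with $T=\sum_{i,j,k}N_{ijk}\,a_i\otimes b_j\otimes c_k$, where $N_{ijk}$ is the coefficient of $x_i$ in the $(j,k)$ entry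 of $N$ (so $T$ lies in the $\mathrm{GL}$-orbit of the tensor defined by $N$). **Theorem.** Let $T\in V_1\otimes V_2\otimes V_3$ be a concise tensor with $\dim V_1=3$, $\dim V_2=2$ and $\dim V_3\ge 3$. Then $\mathscr{C}^1_2(T)$ is, up to a linear embedding of projective spaces, one of the following six varieties, and each case occurs exactly for the listed orbits: 1. the projective line $\mathbb{P}^1$, if and only if $T$ has one of the normal forms $$\begin{pmatrix}x_0&x_1&x_2\\0&x_0&0\end{pmatrix},\quad \begin{pmatrix}x_0&x_1&0\\0&0&x_2\end{pmatrix};$$ 2. the projective plane $\mathbb{P}^2$, if and only if $T$ has one of the normal forms $$\begin{pmatrix}x_0&0&x_1\\0&x_0&x_2\end{pmatrix},\ \begin{pmatrix}x_0&x_1&x_2\\0&x_0&x_1\end{pmatrix},\ \begin{pmatrix}x_0&x_1&0\\0&x_0&x_2\end{pmatrix},\ \begin{pmatrix}x_0&0&x_2\\0&x_1&x_2\end{pmatrix},\ \begin{pmatrix}x_0&0&x_1&x_2\\0&x_0&0&0\end{pmatrix};$$ 3. the quadric cone $\{z_0z_2=z_1^2\}\subset\mathbb{P}^3$, if and only if $T$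 has the normal form $\begin{pmatrix}x_0&0&x_1&x_2\\0&x_0&0&x_1\end{pmatrix}$; 4. the smooth quadric surface $\{z_0z_3=z_1z_2\}\subset\mathbb{P}^3$, if and only if $T$ has the normal form $\begin{pmatrix}x_0&0&x_1&0\\0&x_0&0&x_2\end{pmatrix}$; 5. the rational cubic scroll $S_{(1,2)}=\{(su:sv:tu^2:tuv:tv^2)\}\subset\mathbb{P}^4$, if and only if $T$ has one of the normal forms $$\begin{pmatrix}x_0&x_1&0&x_2\\0&x_0&x_1&0\end{pmatrix},\quad \begin{pmatrix}x_0&0&x_1&0&x_2\\0&x_0&0&x_1&0\end{pmatrix};$$ 6. the Veronese surface $\nu_2(\mathbb{P}^2)\subset\mathbb{P}^5$, if and only if $T$ has one of the normal forms $$\begin{pmatrix}x_0&x_1&x_2&0\\0&x_0&x_1&x_2\end{pmatrix},\ \begin{pmatrix}x_0&0&x_1&x_2&0\\0&x_0&0&x_1&x_2\end{pmatrix},\ \begin{pmatrix}x_0&0&x_1&0&x_2&0\\0&x_0&0&x_1&0&x_2\end{pmatrix}.$$ -/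

import Mathlib

open scoped TensorProduct LinearAlgebra.Projectivization

namespace Collineation

noncomputable section

section Tensors

variable {V W : Type*} [AddCommGroup V] [Module ℂ V] [AddCommGroup W] [Module ℂ W]

/-- Contraction of the first factor with a linear form: `v ⊗ w ↦ φ(v) w`. -/
def contractFst (φ : Module.Dual ℂ V) : V ⊗[ℂ] W →ₗ[ℂ] W :=
  (TensorProduct.lid ℂ W).toLinearMap ∘ₗ φ.rTensor W

/-- Contraction of the second factor with a linear form: `v ⊗ w ↦ φ(w) v`. -/
def contractSnd (φ : Module.Dual ℂ W) : V ⊗[ℂ] W →ₗ[ℂ] V :=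
  (TensorProduct.rid ℂ V).toLinearMap ∘ₗ φ.lTensor V

theorem contractFst_tmul (φ : Module.Dual ℂ V) (v : V) (w : W) :
    contractFst φ (v ⊗ₜ[ℂ] w) = φ v • w := by
  simp [contractFst]

theorem contractSnd_tmul (φ : Module.Dual ℂ W) (v : V) (w : W) :
    contractSnd φ (v ⊗ₜ[ℂ] w) = φ w • v := by
  simp [contractSnd]

/-- An element of `V ⊗ W` regarded as a linear map `V* → W`. -/
def toHom (t : V ⊗[ℂ] W) : Module.Dual ℂ V →ₗ[ℂ] W where
  toFun φ := contractFst φ t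
  map_add' φ ψ := by simp [contractFst, LinearMap.rTensor_add]
  map_smul' r φ := by simp [contractFst, LinearMap.rTensor_smul]

variable {V₁ V₂ V₃ : Type*} [AddCommGroup V₁] [Module ℂ V₁] [AddCommGroup V₂] [Module ℂ V₂]
  [AddCommGroup V₃] [Module ℂ V₃]

/-- The first flattening `V₁* → V₂ ⊗ V₃`. -/
def flattening₁ (T : V₁ ⊗[ℂ] (V₂ ⊗[ℂ] V₃)) (φ : Module.Dual ℂ V₁) : V₂ ⊗[ℂ] V₃ :=
  contractFst φ T

/-- The second flattening `V₂* → V₁ ⊗ V₃`. -/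
def flattening₂ (T : V₁ ⊗[ℂ] (V₂ ⊗[ℂ] V₃)) (φ : Module.Dual ℂ V₂) : V₁ ⊗[ℂ] V₃ :=
  (contractFst φ).lTensor V₁ T

/-- The third flattening `V₃* → V₁ ⊗ V₂`. -/
def flattening₃ (T : V₁ ⊗[ℂ] (V₂ ⊗[ℂ] V₃)) (φ : Module.Dual ℂ V₃) : V₁ ⊗[ℂ] V₂ :=
  (contractSnd φ).lTensor V₁ T

/-- A tensor is concise if its three flattening maps are injective. -/
def IsConcise (T : V₁ ⊗[ℂ] (V₂ ⊗[ℂ] V₃)) : Prop :=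
  Function.Injective (flattening₁ T) ∧ Function.Injective (flattening₂ T) ∧
    Function.Injective (flattening₃ T)

/-- The space `Hom(Λᵏ V₂*, Λᵏ V₃)`, canonically identified with `Λᵏ V₂ ⊗ Λᵏ V₃` when the spaces
are finite-dimensional. -/
abbrev MinorSpace (k : ℕ) (V₂ V₃ : Type*) [AddCommGroup V₂] [Module ℂ V₂]
    [AddCommGroup V₃] [Module ℂ V₃] : Type _ :=
  (⋀[ℂ]^k (Module.Dual ℂ V₂)) →ₗ[ℂ] (⋀[ℂ]^k V₃)

/-- The polynomial map `V₁* → Λᵏ V₂ ⊗ Λᵏ V₃` sending `φ` to the `k`-th exterior power of the linear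
map `V₂* → V₃` given by the first flattening at `φ`. Its coordinates in the bases induced by
bases of `V₂`, `V₃` are the `k × k` minors of the matrix of linear forms attached to `T`. -/
def minorMap (k : ℕ) (T : V₁ ⊗[ℂ] (V₂ ⊗[ℂ] V₃)) (φ : Module.Dual ℂ V₁) : MinorSpace k V₂ V₃ :=
  exteriorPower.map k (toHom (flattening₁ T φ))

end Tensors

section ProjectiveVarieties

variable {W E : Type*} [AddCommGroup W] [Module ℂ W] [AddCommGroup E] [Module ℂ E]

/-- A polynomial in linear forms on `W`, evaluated at a vector of `W`. -/
def polyEval (F : MvPolynomial (Module.Dual ℂ W) ℂ) (w : W) : ℂ :=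
  MvPolynomial.eval (fun φ : Module.Dual ℂ W => φ w) F

/-- The Zariski closure of a set of points of `ℙ(W)`: the points at which every homogeneous
polynomial that vanishes on the set vanishes. For homogeneous polynomials the vanishing does not
depend on the representatives. -/
def zariskiClosure (S : Set (ℙ ℂ W)) : Set (ℙ ℂ W) :=
  {p | ∀ (d : ℕ) (F : MvPolynomial (Module.Dual ℂ W) ℂ), F.IsHomogeneous d →
    (∀ q ∈ S, polyEval F q.rep = 0) → polyEval F p.rep = 0}

/-- `X ⊆ ℙ(W)` is a copy of `Y ⊆ ℙ(E)`: the image of `Y` under the embedding `ℙ(E) → ℙ(W)`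
induced by an injective linear map. -/
def IsLinearCopy (X : Set (ℙ ℂ W)) (Y : Set (ℙ ℂ E)) : Prop :=
  ∃ (f : E →ₗ[ℂ] W) (hf : Function.Injective f), X = Projectivization.map f hf '' Y

/-- The projective line. -/
def projLine : Set (ℙ ℂ (Fin 2 → ℂ)) := Set.univ

/-- The projective plane. -/
def projPlane : Set (ℙ ℂ (Fin 3 → ℂ)) := Set.univ

/-- The quadric cone `z₀ z₂ = z₁²` in `ℙ³`, the cone over a smooth conic. -/
def quadricCone : Set (ℙ ℂ (Fin 4 → ℂ)) := {p | p.rep 0 * p.rep 2 = p.rep 1 ^ 2}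

/-- The smooth quadric surface `z₀ z₃ = z₁ z₂` in `ℙ³`. -/
def smoothQuadric : Set (ℙ ℂ (Fin 4 → ℂ)) := {p | p.rep 0 * p.rep 3 = p.rep 1 * p.rep 2}

/-- The cubic scroll `S₍₁,₂₎` in `ℙ⁴`: the union of the lines joining the points `(u : v)` of a line
to the corresponding points `(u² : uv : v²)` of a conic in a complementary plane. -/
def cubicScroll : Set (ℙ ℂ (Fin 5 → ℂ)) :=
  {p | ∃ s t u v : ℂ, p.rep = ![s * u, s * v, t * u ^ 2, t * (u * v), t * v ^ 2]}

/-- The Veronese surface `ν₂(ℙ²)` in `ℙ⁵`. -/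
def veroneseSurface : Set (ℙ ℂ (Fin 6 → ℂ)) :=
  {p | ∃ x y z : ℂ, p.rep = ![x ^ 2, x * y, x * z, y ^ 2, y * z, z ^ 2]}

end ProjectiveVarieties

section CollineationVarieties

variable {V₁ V₂ V₃ : Type*} [AddCommGroup V₁] [Module ℂ V₁] [AddCommGroup V₂] [Module ℂ V₂]
  [AddCommGroup V₃] [Module ℂ V₃]

/-- The `k`-th collineation variety of `T` on its first factor: the closure of the image of the
rational map `ℙ(V₁*) ⇢ ℙ(Λᵏ V₂ ⊗ Λᵏ V₃)` given by the `k × k` minors. -/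
def collineationVariety (k : ℕ) (T : V₁ ⊗[ℂ] (V₂ ⊗[ℂ] V₃)) : Set (ℙ ℂ (MinorSpace k V₂ V₃)) :=
  zariskiClosure {p | ∃ (φ : Module.Dual ℂ V₁) (h : minorMap k T φ ≠ 0),
    p = Projectivization.mk ℂ (minorMap k T φ) h}

/-- `T` has, in suitable bases of the three factors, the `2 × m` matrix of linear forms `N` in three
variables as the matrix of its first flattening; equivalently, `T` lies in the orbit of the
tensor `∑ Nᵢⱼₖ eᵢ ⊗ eⱼ ⊗ eₖ`, where `Nᵢ` is the coefficient matrix of the `i`-th variable, under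
the product of the general linear groups. In particular `dim V₃ = m`. -/
def HasNormalForm {m : ℕ} (T : V₁ ⊗[ℂ] (V₂ ⊗[ℂ] V₃))
    (N : (Fin 3 → ℂ) → Matrix (Fin 2) (Fin m) ℂ) : Prop :=
  ∃ (a : Module.Basis (Fin 3) ℂ V₁) (b : Module.Basis (Fin 2) ℂ V₂)
    (c : Module.Basis (Fin m) ℂ V₃),
    T = ∑ i, ∑ j, ∑ k, N (Pi.single i 1) j k • (a i ⊗ₜ[ℂ] (b j ⊗ₜ[ℂ] c k))

end CollineationVarieties

section NormalForms

/-! The normal forms of the concise tensors in `ℂ³ ⊗ ℂ² ⊗ ℂᵐ` with `m ≥ 3`. Each is named after its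
decomposition as a pencil of `3 × m` matrices into Kronecker blocks: `L h` of size `h × (h+1)`,
`R h` of size `(h+1) × h`, and Jordan blocks `J h`, where primes indicate different eigenvalues. -/

def netJ2J1 (x : Fin 3 → ℂ) : Matrix (Fin 2) (Fin 3) ℂ :=
  !![x 0, x 1, x 2;
     0,   x 0, 0]

def netJ1J1J1' (x : Fin 3 → ℂ) : Matrix (Fin 2) (Fin 3) ℂ :=
  !![x 0, x 1, 0;
     0,   0,   x 2]

def netL1R1 (x : Fin 3 → ℂ) : Matrix (Fin 2) (Fin 3) ℂ :=
  !![x 0, 0,   x 1;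
     0,   x 0, x 2]

def netJ3 (x : Fin 3 → ℂ) : Matrix (Fin 2) (Fin 3) ℂ :=
  !![x 0, x 1, x 2;
     0,   x 0, x 1]

def netJ2J1' (x : Fin 3 → ℂ) : Matrix (Fin 2) (Fin 3) ℂ :=
  !![x 0, x 1, 0;
     0,   x 0, x 2]

def netJ1J1'J1'' (x : Fin 3 → ℂ) : Matrix (Fin 2) (Fin 3) ℂ :=
  !![x 0, 0,   x 2;
     0,   x 1, x 2]

def netL1J1J1 (x : Fin 3 → ℂ) : Matrix (Fin 2) (Fin 4) ℂ :=
  !![x 0, 0,   x 1, x 2;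
     0,   x 0, 0,   0]

def netL1J2 (x : Fin 3 → ℂ) : Matrix (Fin 2) (Fin 4) ℂ :=
  !![x 0, 0,   x 1, x 2;
     0,   x 0, 0,   x 1]

def netL1J1J1' (x : Fin 3 → ℂ) : Matrix (Fin 2) (Fin 4) ℂ :=
  !![x 0, 0,   x 1, 0;
     0,   x 0, 0,   x 2]

def netL2J1 (x : Fin 3 → ℂ) : Matrix (Fin 2) (Fin 4) ℂ :=
  !![x 0, x 1, 0,   x 2;
     0,   x 0, x 1, 0]

def netL3 (x : Fin 3 → ℂ) : Matrix (Fin 2) (Fin 4) ℂ :=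
  !![x 0, x 1, x 2, 0;
     0,   x 0, x 1, x 2]

def netL1L1J1 (x : Fin 3 → ℂ) : Matrix (Fin 2) (Fin 5) ℂ :=
  !![x 0, 0,   x 1, 0,   x 2;
     0,   x 0, 0,   x 1, 0]

def netL1L2 (x : Fin 3 → ℂ) : Matrix (Fin 2) (Fin 5) ℂ :=
  !![x 0, 0,   x 1, x 2, 0;
     0,   x 0, 0,   x 1, x 2]

def netL1L1L1 (x : Fin 3 → ℂ) : Matrix (Fin 2) (Fin 6) ℂ :=
  !![x 0, 0,   x 1, 0,   x 2, 0;
     0,   x 0, 0,   x 1, 0,   x 2]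

end NormalForms

end

end Collineation

namespace Collineation

noncomputable section

/-! ### Zariski closures computed through Euclidean limits -/

section Closure

open Filter Topology

variable {W E : Type*} [AddCommGroup W] [Module ℂ W] [AddCommGroup E] [Module ℂ E]

/-! Fix a basis of `V₂`. The third flattening then embeds `V₃*` into `V₁ ⊗ ℂ² = V₁ × V₁`
(`sliceMap`), and its image `U` is the span of the columns of the matrix of linear forms. A change
of basis of `V₃` does not move `U`, so the orbit of `T` is the orbit of `U` under `GL(V₁) × GL₂`.
Conciseness becomes `IsConciseSubspace U`, and `dim V₃ = dim U ≤ 6`.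

Such subspaces are classified by hand, dimension by dimension, in place of Kronecker's theory of
pencils. The main tool is `exists_rank_one`, which is the existence of an eigenvector in disguise.
In dimension three, `U` has rank-one elements `w ⊗ e` for two different directions `e` of `ℂ²`, or
it is the graph of a nilpotent endomorphism. In dimension four the question is whether `U` contains
some `x ⊗ ℂ²`, and if not, whether it contains a plane of rank-one elements with a common direction.
Dimension five concerns hyperplanes, and dimension six is the whole space. The outcome is
`exists_normalForm`, with fourteen normal forms.

For each form the minors are an injective linear function of a quadratic map `q` on `ℂ³`. By
`HasNormalForm.isLinearCopy` it remains to see that `q` maps into the target variety, that the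
target is Zariski closed, and that its vectors are Euclidean limits of multiples of values of `q`.
The map `q` is given by all conics (Veronese surface), by the conics through one point (cubic
scroll), by those through two points (smooth quadric) or two infinitely near ones (quadric cone), or
it maps dominantly to a line or a plane.

Finally the six varieties are mutually exclusive: their linear spans have dimensions 2, 3, 4, 4, 5,
6 as vector spaces, and of the two quadrics only one has a vertex. Since the normal forms exhaust
all tensors and each determines its variety, every "only if" follows from the "if" statements. -/

theorem polyEval_smul {d : ℕ} {F : MvPolynomial (Module.Dual ℂ W) ℂ} (hF : F.IsHomogeneous d)
    (c : ℂ) (w : W) : polyEval F (c • w) = c ^ d * polyEval F w := by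
  unfold polyEval
  rw [MvPolynomial.eval_eq, MvPolynomial.eval_eq, Finset.mul_sum]
  refine Finset.sum_congr rfl fun m hm => ?_
  have hd : ∑ i ∈ m.support, m i = d := by
    have := hF (MvPolynomial.mem_support_iff.1 hm)
    rw [Finsupp.weight_apply] at this
    simpa [Finsupp.sum] using this
  simp only [map_smul, smul_eq_mul, mul_pow, Finset.prod_mul_distrib, Finset.prod_pow_eq_pow_sum,
    hd]
  ring

theorem polyEval_rep {d : ℕ} {F : MvPolynomial (Module.Dual ℂ W) ℂ} (hF : F.IsHomogeneous d)
    (w : W) (hw : w ≠ 0) :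
    polyEval F (Projectivization.mk ℂ w hw).rep = 0 ↔ polyEval F w = 0 := by
  obtain ⟨a, ha⟩ := Projectivization.exists_smul_eq_mk_rep ℂ w hw
  rw [← ha, Units.smul_def, polyEval_smul hF]
  simp

/-- Pullback of a polynomial along a linear map. -/
def polyPullback (f : E →ₗ[ℂ] W) (F : MvPolynomial (Module.Dual ℂ W) ℂ) :
    MvPolynomial (Module.Dual ℂ E) ℂ :=
  MvPolynomial.rename (fun φ : Module.Dual ℂ W => φ ∘ₗ f) F

theorem polyEval_pullback (f : E →ₗ[ℂ] W) (F : MvPolynomial (Module.Dual ℂ W) ℂ) (e : E) :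
    polyEval (polyPullback f F) e = polyEval F (f e) := by
  simp [polyEval, polyPullback, MvPolynomial.eval_rename, Function.comp_def]

theorem isHomogeneous_pullback (f : E →ₗ[ℂ] W) {d : ℕ} {F : MvPolynomial (Module.Dual ℂ W) ℂ}
    (hF : F.IsHomogeneous d) : (polyPullback f F).IsHomogeneous d :=
  hF.rename_isHomogeneous

theorem continuous_polyEval {n : ℕ} (F : MvPolynomial (Module.Dual ℂ (Fin n → ℂ)) ℂ) :
    Continuous (polyEval F) :=
  (MvPolynomial.continuous_eval F).comp
    (continuous_pi fun φ => LinearMap.continuous_of_finiteDimensional φ)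

/-- If `S` lies in the image of a closed set `Y` under a linear embedding and the image of `Y`
lies in the closure of `S`, then the closure of `S` is a copy of `Y`. -/
theorem isLinearCopy_zariskiClosure {S : Set (ℙ ℂ W)} {Y : Set (ℙ ℂ E)} (f : E →ₗ[ℂ] W)
    (hf : Function.Injective f) (hY : zariskiClosure Y ⊆ Y)
    (hS : ∀ p ∈ S, ∃ p' ∈ Y, Projectivization.map f hf p' = p)
    (hd : ∀ p' ∈ Y, Projectivization.map f hf p' ∈ zariskiClosure S) :
    IsLinearCopy (zariskiClosure S) Y := by
  refine ⟨f, hf, Set.Subset.antisymm ?_ (by rintro _ ⟨p', hp', rfl⟩; exact hd p' hp')⟩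
  intro p hp
  -- A linear form vanishing on the range of `f` is a homogeneous polynomial of degree one vanishing
  -- on `S`, so the closure stays inside the range.
  have hrange : p.rep ∈ LinearMap.range f := by
    by_contra hcon
    obtain ⟨φ, hφ, hφf⟩ := Submodule.exists_le_ker_of_notMem hcon
    refine hφ ?_
    have := hp 1 (MvPolynomial.X φ) (MvPolynomial.isHomogeneous_X _ _) ?_
    · simpa [polyEval] using this
    · intro q hq
      obtain ⟨p', hp', rfl⟩ := hS q hq
      induction p' using Projectivization.ind with
      | h v hv =>
        rw [Projectivization.map_mk, polyEval_rep (MvPolynomial.isHomogeneous_X _ _)]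
        simpa [polyEval] using hφf ⟨v, rfl⟩
  obtain ⟨e, he⟩ := hrange
  have he0 : e ≠ 0 := by
    rintro rfl
    exact p.rep_nonzero (by rw [← he, map_zero])
  refine ⟨Projectivization.mk ℂ e he0, hY ?_, ?_⟩
  · intro d F hF hFY
    rw [polyEval_rep hF]
    -- Equations of `Y` live on `E`; a linear left inverse of `f` turns them into equations on `W`.
    obtain ⟨g, hg⟩ := f.exists_leftInverse_of_injective (LinearMap.ker_eq_bot.2 hf)
    have hgf : ∀ x, g (f x) = x := fun x => LinearMap.congr_fun hg x
    have := hp d (polyPullback g F) (isHomogeneous_pullback g hF) ?_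
    · rwa [polyEval_pullback, ← he, hgf] at this
    · intro q hq
      obtain ⟨p', hp', rfl⟩ := hS q hq
      have h := hFY p' hp'
      induction p' using Projectivization.ind with
      | h v hv =>
        rw [Projectivization.map_mk, polyEval_rep (isHomogeneous_pullback g hF), polyEval_pullback,
          hgf]
        rwa [polyEval_rep hF] at h
  · rw [Projectivization.map_mk, ← p.mk_rep]
    congr 1

/-- The vectors that are, up to scaling, nonzero values of `q`. -/
def valueCone {ι E : Type*} [AddCommGroup E] [Module ℂ E] (q : ι → E) : Set E :=
  {w | w ≠ 0 ∧ ∃ c : ℂ, c ≠ 0 ∧ ∃ x, q x = c • w}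

/-- Zero sets of polynomials are closed in the Euclidean topology and, for homogeneous ones, stable
under scaling. Hence a polynomial vanishing on the values of `f ∘ q` vanishes at every Euclidean
limit of multiples of them, and explicit curves can replace an argument on dimensions or dominance.
-/
theorem isLinearCopy_of_parametrization {ι : Type*} {n : ℕ} {S : Set (ℙ ℂ W)}
    {Y : Set (ℙ ℂ (Fin n → ℂ))} (q : ι → Fin n → ℂ) (f : (Fin n → ℂ) →ₗ[ℂ] W)
    (hf : Function.Injective f) (hY : zariskiClosure Y ⊆ Y)
    (hS : ∀ p, p ∈ S ↔ ∃ x, ∃ h : f (q x) ≠ 0, p = Projectivization.mk ℂ (f (q x)) h)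
    (hqY : ∀ x, ∀ h : q x ≠ 0, Projectivization.mk ℂ (q x) h ∈ Y)
    (hd : ∀ v, ∀ h : v ≠ 0, Projectivization.mk ℂ v h ∈ Y → v ∈ closure (valueCone q)) :
    IsLinearCopy (zariskiClosure S) Y := by
  have hne : ∀ x, f (q x) ≠ 0 ↔ q x ≠ 0 := fun x => by
    rw [Ne, Ne, map_eq_zero_iff f hf]
  refine isLinearCopy_zariskiClosure f hf hY ?_ ?_
  · intro p hp
    obtain ⟨x, h, rfl⟩ := (hS p).1 hp
    exact ⟨_, hqY x ((hne x).1 h), Projectivization.map_mk f hf _ _⟩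
  · intro p' hp'
    induction p' using Projectivization.ind with
    | h v hv =>
      intro d F hF hFS
      rw [Projectivization.map_mk, polyEval_rep hF, ← polyEval_pullback]
      have hcl : IsClosed {w | polyEval (polyPullback f F) w = 0} :=
        isClosed_singleton.preimage (continuous_polyEval (polyPullback f F))
      refine closure_minimal ?_ hcl (hd v hv hp')
      rintro w ⟨hw, c, hc, x, hx⟩
      have hqx : q x ≠ 0 := by rw [hx]; exact smul_ne_zero hc hw
      have h := hFS _ ((hS _).2 ⟨x, (hne x).2 hqx, rfl⟩)
      rw [polyEval_rep hF, hx, map_smul, polyEval_smul hF] at h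
      rw [Set.mem_ofPred_eq, polyEval_pullback]
      exact (mul_eq_zero.1 h).resolve_left (pow_ne_zero _ hc)

theorem mem_closure_of_curve {X : Type*} [TopologicalSpace X] {D : Set X} {v : ℂ → X}
    (hv : Continuous v) (h : ∀ᶠ t in 𝓝[≠] (0 : ℂ), v t ∈ D) : v 0 ∈ closure D :=
  mem_closure_of_tendsto ((hv.tendsto 0).mono_left nhdsWithin_le_nhds) h

theorem eventually_add_ne_zero (a : ℂ) : ∀ᶠ t in 𝓝[≠] (0 : ℂ), a + t ≠ 0 := by
  by_cases ha : a = 0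
  · filter_upwards [self_mem_nhdsWithin] with t ht
    simpa [ha] using ht
  · have : Tendsto (fun t : ℂ => a + t) (𝓝[≠] 0) (𝓝 (a + 0)) :=
      ((continuous_const.add continuous_id).tendsto 0).mono_left nhdsWithin_le_nhds
    exact this.eventually_ne (by simpa using ha)

end Closure

/-! ### Affine cones and the dimension of the linear span -/

section Cones

variable {W E : Type*} [AddCommGroup W] [Module ℂ W] [AddCommGroup E] [Module ℂ E]

/-- The nonzero vectors representing the points of a subset of projective space. -/
def puncturedCone (Y : Set (ℙ ℂ E)) : Set E :=
  {v | ∃ h : v ≠ 0, Projectivization.mk ℂ v h ∈ Y}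

theorem puncturedCone_image (f : E →ₗ[ℂ] W) (hf : Function.Injective f) (Y : Set (ℙ ℂ E)) :
    puncturedCone (Projectivization.map f hf '' Y) = f '' puncturedCone Y := by
  ext w
  constructor
  · rintro ⟨hw, p, hp, hpw⟩
    induction p using Projectivization.ind with
    | h v hv =>
      rw [Projectivization.map_mk, Projectivization.mk_eq_mk_iff] at hpw
      obtain ⟨a, ha⟩ := hpw
      have ha' : a⁻¹ • v ≠ 0 := smul_ne_zero (Units.ne_zero a⁻¹) hv
      refine ⟨a⁻¹ • v, ⟨ha', ?_⟩, ?_⟩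
      · convert hp using 1
        rw [Projectivization.mk_eq_mk_iff]
        exact ⟨a⁻¹, rfl⟩
      · rw [Units.smul_def, map_smul, ← ha, ← Units.smul_def, inv_smul_smul]
  · rintro ⟨v, ⟨hv, hvY⟩, rfl⟩
    exact ⟨(map_ne_zero_iff f hf).2 hv, _, hvY, Projectivization.map_mk f hf _ _⟩

/-- A linear embedding preserves the dimension of the span, so this number is an invariant of linear
copies; it separates all six varieties except the two quadrics. -/
theorem finrank_span_puncturedCone {X : Set (ℙ ℂ W)} {Y : Set (ℙ ℂ E)} (h : IsLinearCopy X Y)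
    (hY : Submodule.span ℂ (puncturedCone Y) = ⊤) :
    Module.finrank ℂ (Submodule.span ℂ (puncturedCone X)) = Module.finrank ℂ E := by
  obtain ⟨f, hf, rfl⟩ := h
  rw [puncturedCone_image, Submodule.span_image, hY, Submodule.map_top,
    LinearMap.finrank_range_of_inj hf]

end Cones

/-! ### Equations and spans of the six varieties -/

section Varieties

/-- Replacing the representative multiplies both sides of a quadratic equation by the same square,
so the equation may be tested on any vector. -/
theorem mk_mem_quadricCone {v : Fin 4 → ℂ} (hv : v ≠ 0) :
    Projectivization.mk ℂ v hv ∈ quadricCone ↔ v 0 * v 2 = v 1 ^ 2 := by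
  obtain ⟨a, ha⟩ := Projectivization.exists_smul_eq_mk_rep ℂ v hv
  have ha0 : (a : ℂ) ^ 2 ≠ 0 := pow_ne_zero _ a.ne_zero
  simp only [quadricCone, Set.mem_ofPred_eq, ← ha, Units.smul_def, Pi.smul_apply, smul_eq_mul]
  rw [← mul_right_inj' ha0 (b := v 0 * v 2)]
  ring_nf

theorem mk_mem_smoothQuadric {v : Fin 4 → ℂ} (hv : v ≠ 0) :
    Projectivization.mk ℂ v hv ∈ smoothQuadric ↔ v 0 * v 3 = v 1 * v 2 := by
  obtain ⟨a, ha⟩ := Projectivization.exists_smul_eq_mk_rep ℂ v hv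
  have ha0 : (a : ℂ) ^ 2 ≠ 0 := pow_ne_zero _ a.ne_zero
  simp only [smoothQuadric, Set.mem_ofPred_eq, ← ha, Units.smul_def, Pi.smul_apply, smul_eq_mul]
  rw [← mul_right_inj' ha0 (b := v 0 * v 3)]
  ring_nf

/-- The equations are the minors of the matrix with rows `(v₀, v₂, v₃)` and `(v₁, v₃, v₄)`, whose
rows are proportional with ratio `(u : w)`. Conversely this ratio is read off from a nonzero entry
of the conic part `(v₂, v₃, v₄)`; if that part is zero, the point lies on the directrix line and `t
= 0`. -/
theorem cubicScroll_iff (v : Fin 5 → ℂ) :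
    (∃ s t u w : ℂ, v = ![s * u, s * w, t * u ^ 2, t * (u * w), t * w ^ 2]) ↔
      v 0 * v 3 = v 1 * v 2 ∧ v 0 * v 4 = v 1 * v 3 ∧ v 2 * v 4 = v 3 ^ 2 := by
  constructor
  · rintro ⟨s, t, u, w, rfl⟩
    simp only [Matrix.cons_val]
    refine ⟨?_, ?_, ?_⟩ <;> ring
  · rintro ⟨h1, h2, h3⟩
    by_cases h : v 2 = 0
    · have h' : v 3 = 0 := by
        rw [h, zero_mul] at h3
        exact pow_eq_zero_iff two_ne_zero |>.1 h3.symm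
      by_cases h4 : v 4 = 0
      · refine ⟨1, 0, v 0, v 1, ?_⟩
        ext i; fin_cases i <;> simp [h, h', h4]
      · have h0 : v 0 = 0 := by simpa [h', h4] using h2
        refine ⟨v 1, v 4, 0, 1, ?_⟩
        ext i; fin_cases i <;> simp [h, h', h0]
    · refine ⟨v 0 / v 2, 1 / v 2, v 2, v 3, ?_⟩
      ext i; fin_cases i <;> simp <;> field_simp
      · linear_combination -h1
      · linear_combination h3

/-- The Veronese surface consists of the symmetric `3 × 3` matrices of rank at most one; four of the
six minors already cut it out as a set. The converse takes a square root of a nonzero diagonal entry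
and divides its row by that root. -/
theorem veroneseSurface_iff (v : Fin 6 → ℂ) :
    (∃ x y z : ℂ, v = ![x ^ 2, x * y, x * z, y ^ 2, y * z, z ^ 2]) ↔
      v 0 * v 3 = v 1 ^ 2 ∧ v 0 * v 5 = v 2 ^ 2 ∧ v 3 * v 5 = v 4 ^ 2 ∧
        v 0 * v 4 = v 1 * v 2 := by
  constructor
  · rintro ⟨x, y, z, rfl⟩
    simp only [Matrix.cons_val]
    refine ⟨?_, ?_, ?_, ?_⟩ <;> ring
  · rintro ⟨h1, h2, h3, h4⟩
    by_cases h : v 0 = 0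
    · have h10 : v 1 = 0 := by
        rw [h, zero_mul] at h1
        exact pow_eq_zero_iff two_ne_zero |>.1 h1.symm
      have h20 : v 2 = 0 := by
        rw [h, zero_mul] at h2
        exact pow_eq_zero_iff two_ne_zero |>.1 h2.symm
      by_cases h' : v 3 = 0
      · have h40 : v 4 = 0 := by
          rw [h', zero_mul] at h3
          exact pow_eq_zero_iff two_ne_zero |>.1 h3.symm
        obtain ⟨z, hz⟩ := IsAlgClosed.exists_pow_nat_eq (v 5) two_pos
        refine ⟨0, 0, z, ?_⟩
        ext i; fin_cases i <;> simp [h, h10, h20, h', h40, hz]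
      · obtain ⟨y, hy⟩ := IsAlgClosed.exists_pow_nat_eq (v 3) two_pos
        have hy0 : y ≠ 0 := by rintro rfl; exact h' (by rw [← hy]; simp)
        refine ⟨0, y, v 4 / y, ?_⟩
        ext i; fin_cases i <;> simp [h, h10, h20, hy]
        · field_simp
        · field_simp
          rw [hy, ← h3]; ring
    · obtain ⟨x, hx⟩ := IsAlgClosed.exists_pow_nat_eq (v 0) two_pos
      have hx0 : x ≠ 0 := by rintro rfl; exact h (by rw [← hx]; simp)
      refine ⟨x, v 1 / x, v 2 / x, ?_⟩
      ext i; fin_cases i <;> simp [hx] <;> field_simp <;> rw [hx]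
      · linear_combination h1
      · linear_combination h4
      · linear_combination h2

theorem mk_mem_cubicScroll {v : Fin 5 → ℂ} (hv : v ≠ 0) :
    Projectivization.mk ℂ v hv ∈ cubicScroll ↔
      v 0 * v 3 = v 1 * v 2 ∧ v 0 * v 4 = v 1 * v 3 ∧ v 2 * v 4 = v 3 ^ 2 := by
  obtain ⟨a, ha⟩ := Projectivization.exists_smul_eq_mk_rep ℂ v hv
  have ha0 : (a : ℂ) ^ 2 ≠ 0 := pow_ne_zero _ a.ne_zero
  rw [cubicScroll, Set.mem_ofPred_eq, cubicScroll_iff]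
  simp only [← ha, Units.smul_def, Pi.smul_apply, smul_eq_mul]
  rw [← mul_right_inj' ha0 (b := v 0 * v 3), ← mul_right_inj' ha0 (b := v 0 * v 4),
    ← mul_right_inj' ha0 (b := v 2 * v 4)]
  ring_nf

theorem mk_mem_veroneseSurface {v : Fin 6 → ℂ} (hv : v ≠ 0) :
    Projectivization.mk ℂ v hv ∈ veroneseSurface ↔
      v 0 * v 3 = v 1 ^ 2 ∧ v 0 * v 5 = v 2 ^ 2 ∧ v 3 * v 5 = v 4 ^ 2 ∧
        v 0 * v 4 = v 1 * v 2 := by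
  obtain ⟨a, ha⟩ := Projectivization.exists_smul_eq_mk_rep ℂ v hv
  have ha0 : (a : ℂ) ^ 2 ≠ 0 := pow_ne_zero _ a.ne_zero
  rw [veroneseSurface, Set.mem_ofPred_eq, veroneseSurface_iff]
  simp only [← ha, Units.smul_def, Pi.smul_apply, smul_eq_mul]
  rw [← mul_right_inj' ha0 (b := v 0 * v 3), ← mul_right_inj' ha0 (b := v 0 * v 5),
    ← mul_right_inj' ha0 (b := v 3 * v 5), ← mul_right_inj' ha0 (b := v 0 * v 4)]
  ring_nf

/-- A set defined by quadratic equations `z_i z_j = z_k z_l` contains its Zariski closure. -/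
theorem mul_eq_mul_of_mem_zariskiClosure {n : ℕ} {Y : Set (ℙ ℂ (Fin n → ℂ))} (i j k l : Fin n)
    (hY : ∀ v, ∀ h : v ≠ 0, Projectivization.mk ℂ v h ∈ Y → v i * v j = v k * v l)
    {v : Fin n → ℂ} {h : v ≠ 0} (hv : Projectivization.mk ℂ v h ∈ zariskiClosure Y) :
    v i * v j = v k * v l := by
  have hF : (MvPolynomial.X (LinearMap.proj i) * MvPolynomial.X (LinearMap.proj j) -
      MvPolynomial.X (LinearMap.proj k) * MvPolynomial.X (LinearMap.proj l) :
      MvPolynomial (Module.Dual ℂ (Fin n → ℂ)) ℂ).IsHomogeneous (1 + 1) :=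
    ((MvPolynomial.isHomogeneous_X _ _).mul (MvPolynomial.isHomogeneous_X _ _)).sub
      ((MvPolynomial.isHomogeneous_X _ _).mul (MvPolynomial.isHomogeneous_X _ _))
  have := hv _ _ hF ?_
  · rw [polyEval_rep hF] at this
    simpa [polyEval, sub_eq_zero] using this
  · intro p hp
    have h := hY p.rep p.rep_nonzero (by rwa [p.mk_rep])
    simpa [polyEval, sub_eq_zero] using h

theorem zariskiClosure_quadricCone : zariskiClosure quadricCone ⊆ quadricCone := by
  intro p hp
  induction p using Projectivization.ind with
  | h v hv =>
    rw [mk_mem_quadricCone, pow_two]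
    refine mul_eq_mul_of_mem_zariskiClosure 0 2 1 1 (fun w hw h => ?_) hp
    rw [mk_mem_quadricCone, pow_two] at h
    exact h

theorem zariskiClosure_smoothQuadric : zariskiClosure smoothQuadric ⊆ smoothQuadric := by
  intro p hp
  induction p using Projectivization.ind with
  | h v hv =>
    rw [mk_mem_smoothQuadric]
    exact mul_eq_mul_of_mem_zariskiClosure 0 3 1 2 (fun w hw h => (mk_mem_smoothQuadric hw).1 h) hp

theorem zariskiClosure_cubicScroll : zariskiClosure cubicScroll ⊆ cubicScroll := by
  intro p hp
  induction p using Projectivization.ind with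
  | h v hv =>
    rw [mk_mem_cubicScroll, pow_two]
    refine ⟨mul_eq_mul_of_mem_zariskiClosure 0 3 1 2 (fun w hw h => ?_) hp,
      mul_eq_mul_of_mem_zariskiClosure 0 4 1 3 (fun w hw h => ?_) hp,
      mul_eq_mul_of_mem_zariskiClosure 2 4 3 3 (fun w hw h => ?_) hp⟩ <;>
    · rw [mk_mem_cubicScroll, pow_two] at h
      tauto

theorem zariskiClosure_veroneseSurface : zariskiClosure veroneseSurface ⊆ veroneseSurface := by
  intro p hp
  induction p using Projectivization.ind with
  | h v hv =>
    rw [mk_mem_veroneseSurface, pow_two, pow_two, pow_two]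
    refine ⟨mul_eq_mul_of_mem_zariskiClosure 0 3 1 1 (fun w hw h => ?_) hp,
      mul_eq_mul_of_mem_zariskiClosure 0 5 2 2 (fun w hw h => ?_) hp,
      mul_eq_mul_of_mem_zariskiClosure 3 5 4 4 (fun w hw h => ?_) hp,
      mul_eq_mul_of_mem_zariskiClosure 0 4 1 2 (fun w hw h => ?_) hp⟩ <;>
    · rw [mk_mem_veroneseSurface, pow_two, pow_two, pow_two] at h
      tauto

theorem span_puncturedCone_univ (n : ℕ) :
    Submodule.span ℂ (puncturedCone (Set.univ : Set (ℙ ℂ (Fin n → ℂ)))) = ⊤ := by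
  refine eq_top_iff.2 fun v _ => ?_
  by_cases hv : v = 0
  · rw [hv]; exact zero_mem _
  · exact Submodule.subset_span ⟨hv, trivial⟩

theorem span_puncturedCone_smoothQuadric :
    Submodule.span ℂ (puncturedCone smoothQuadric) = ⊤ := by
  refine eq_top_iff.2 fun v _ => ?_
  have key : ∀ w : Fin 4 → ℂ, w ≠ 0 → w 0 * w 3 = w 1 * w 2 →
      w ∈ Submodule.span ℂ (puncturedCone smoothQuadric) :=
    fun w hw h => Submodule.subset_span ⟨hw, (mk_mem_smoothQuadric hw).2 h⟩
  have e : v = v 0 • ![1, 0, 0, 0] + v 1 • ![0, 1, 0, 0] + v 2 • ![0, 0, 1, 0] +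
      v 3 • ![0, 0, 0, 1] := by
    ext i; fin_cases i <;> simp
  rw [e]
  refine add_mem (add_mem (add_mem ?_ ?_) ?_) ?_ <;>
    exact Submodule.smul_mem _ _ (key _ (by simp) (by simp))

theorem span_puncturedCone_quadricCone :
    Submodule.span ℂ (puncturedCone quadricCone) = ⊤ := by
  refine eq_top_iff.2 fun v _ => ?_
  have key : ∀ w : Fin 4 → ℂ, w ≠ 0 → w 0 * w 2 = w 1 ^ 2 →
      w ∈ Submodule.span ℂ (puncturedCone quadricCone) :=
    fun w hw h => Submodule.subset_span ⟨hw, (mk_mem_quadricCone hw).2 h⟩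
  -- The coordinate vector with index 1 is not on the cone; the point `(1, 1, 1, 0)` of the conic
  -- takes its place.
  have e : v = (v 0 - v 1) • ![1, 0, 0, 0] + v 1 • ![1, 1, 1, 0] +
      (v 2 - v 1) • ![0, 0, 1, 0] + v 3 • ![0, 0, 0, 1] := by
    ext i; fin_cases i <;> simp
  rw [e]
  refine add_mem (add_mem (add_mem ?_ ?_) ?_) ?_ <;>
    exact Submodule.smul_mem _ _ (key _ (by simp) (by simp))

theorem span_puncturedCone_cubicScroll :
    Submodule.span ℂ (puncturedCone cubicScroll) = ⊤ := by
  refine eq_top_iff.2 fun v _ => ?_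
  have key : ∀ w : Fin 5 → ℂ, w ≠ 0 →
      w 0 * w 3 = w 1 * w 2 ∧ w 0 * w 4 = w 1 * w 3 ∧ w 2 * w 4 = w 3 ^ 2 →
      w ∈ Submodule.span ℂ (puncturedCone cubicScroll) :=
    fun w hw h => Submodule.subset_span ⟨hw, (mk_mem_cubicScroll hw).2 h⟩
  have e : v = v 0 • ![1, 0, 0, 0, 0] + v 1 • ![0, 1, 0, 0, 0] +
      (v 2 - v 3) • ![0, 0, 1, 0, 0] + v 3 • ![0, 0, 1, 1, 1] +
      (v 4 - v 3) • ![0, 0, 0, 0, 1] := by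
    ext i; fin_cases i <;> simp
  rw [e]
  refine add_mem (add_mem (add_mem (add_mem ?_ ?_) ?_) ?_) ?_ <;>
    exact Submodule.smul_mem _ _ (key _ (by simp) (by simp))

theorem span_puncturedCone_veroneseSurface :
    Submodule.span ℂ (puncturedCone veroneseSurface) = ⊤ := by
  refine eq_top_iff.2 fun v _ => ?_
  have key : ∀ w : Fin 6 → ℂ, w ≠ 0 → w 0 * w 3 = w 1 ^ 2 ∧ w 0 * w 5 = w 2 ^ 2 ∧
      w 3 * w 5 = w 4 ^ 2 ∧ w 0 * w 4 = w 1 * w 2 →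
      w ∈ Submodule.span ℂ (puncturedCone veroneseSurface) :=
    fun w hw h => Submodule.subset_span ⟨hw, (mk_mem_veroneseSurface hw).2 h⟩
  -- The six vectors are the Veronese images of `eᵢ` and `eᵢ + eⱼ`.
  have e : v = (v 0 - v 1 - v 2) • ![1, 0, 0, 0, 0, 0] + (v 3 - v 1 - v 4) • ![0, 0, 0, 1, 0, 0] +
      (v 5 - v 2 - v 4) • ![0, 0, 0, 0, 0, 1] + v 1 • ![1, 1, 0, 1, 0, 0] +
      v 2 • ![1, 0, 1, 0, 0, 1] + v 4 • ![0, 0, 0, 1, 1, 1] := by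
    ext i; fin_cases i <;> simp <;> ring
  rw [e]
  refine add_mem (add_mem (add_mem (add_mem (add_mem ?_ ?_) ?_) ?_) ?_) ?_ <;>
    exact Submodule.smul_mem _ _ (key _ (by simp) (by simp))

/-- The quadric cone has a vertex, the smooth quadric has none. -/
theorem not_isLinearCopy_quadricCone_smoothQuadric {W : Type*} [AddCommGroup W] [Module ℂ W]
    {X : Set (ℙ ℂ W)} (h : IsLinearCopy X quadricCone) (h' : IsLinearCopy X smoothQuadric) :
    False := by
  obtain ⟨f, hf, hX⟩ := h
  obtain ⟨g, hg, hX'⟩ := h'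
  have hcone : f '' puncturedCone quadricCone = g '' puncturedCone smoothQuadric := by
    rw [← puncturedCone_image f hf, ← puncturedCone_image g hg, ← hX, ← hX']
  have hv0 : (![0, 0, 0, 1] : Fin 4 → ℂ) ≠ 0 := by simp
  have hvert : (![0, 0, 0, 1] : Fin 4 → ℂ) ∈ puncturedCone quadricCone :=
    ⟨hv0, (mk_mem_quadricCone hv0).2 (by simp)⟩
  -- `p` is where the vertex of the cone would sit on the smooth quadric. Adding the vertex
  -- preserves the cone, so adding `p` must preserve the smooth quadric.
  obtain ⟨p, ⟨hp0, -⟩, hp⟩ : f ![0, 0, 0, 1] ∈ g '' puncturedCone smoothQuadric :=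
    hcone ▸ ⟨_, hvert, rfl⟩
  have key : ∀ e : Fin 4 → ℂ, e ≠ 0 → e 0 * e 3 = e 1 * e 2 →
      (e + p) 0 * (e + p) 3 = (e + p) 1 * (e + p) 2 := by
    intro e he heq
    obtain ⟨w, ⟨hw0, hw⟩, hwe⟩ : g e ∈ f '' puncturedCone quadricCone :=
      hcone ▸ ⟨e, ⟨he, (mk_mem_smoothQuadric he).2 heq⟩, rfl⟩
    rw [mk_mem_quadricCone] at hw
    by_cases hz : w + ![0, 0, 0, 1] = 0
    · have : g (e + p) = 0 := by rw [map_add, hp, ← hwe, ← map_add, hz, map_zero]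
      rw [(map_eq_zero_iff g hg).1 this]
      simp
    · obtain ⟨u, ⟨hu0, hu⟩, hue⟩ : f (w + ![0, 0, 0, 1]) ∈ g '' puncturedCone smoothQuadric :=
        hcone ▸ ⟨_, ⟨hz, (mk_mem_quadricCone hz).2 (by simpa using hw)⟩, rfl⟩
      have : u = e + p := hg (by rw [hue, map_add, map_add, hwe, hp])
      rw [mk_mem_smoothQuadric] at hu
      rwa [this] at hu
  -- Comparing `e + p` and `-e + p` for each coordinate vector `e` shows that `p` is orthogonal to
  -- `e` for the polar form. This form is nondegenerate, hence `p = 0`.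
  have k0 := key ![1, 0, 0, 0] (by simp) (by simp)
  have k0' := key ![-1, 0, 0, 0] (by simp) (by simp)
  have k1 := key ![0, 1, 0, 0] (by simp) (by simp)
  have k1' := key ![0, -1, 0, 0] (by simp) (by simp)
  have k2 := key ![0, 0, 1, 0] (by simp) (by simp)
  have k2' := key ![0, 0, -1, 0] (by simp) (by simp)
  have k3 := key ![0, 0, 0, 1] (by simp) (by simp)
  have k3' := key ![0, 0, 0, -1] (by simp) (by simp)
  simp at k0 k0' k1 k1' k2 k2' k3 k3'
  refine hp0 ?_
  ext i
  fin_cases i <;> simp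
  · linear_combination (k3 - k3') / 2
  · linear_combination -(k2 - k2') / 2
  · linear_combination -(k1 - k1') / 2
  · linear_combination (k0 - k0') / 2

end Varieties

/-! ### Minors as coordinates on `Hom(Λ² V₂*, Λ² V₃)` -/

section Minors

variable {V₁ V₂ V₃ : Type*} [AddCommGroup V₁] [Module ℂ V₁] [AddCommGroup V₂] [Module ℂ V₂]
  [AddCommGroup V₃] [Module ℂ V₃]

/-- The coordinates of an element of `Hom(Λ² V₂*, Λ² V₃)` in the bases induced by a basis of `V₂`
with two elements and a basis of `V₃`. -/
def minorCoord {m : ℕ} (b : Module.Basis (Fin 2) ℂ V₂) (c : Module.Basis (Fin m) ℂ V₃)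
    (L : MinorSpace 2 V₂ V₃) (k l : Fin m) : ℂ :=
  exteriorPower.pairingDual ℂ V₃ 2 (exteriorPower.ιMulti ℂ 2 ![c.coord k, c.coord l])
    (L (exteriorPower.ιMulti ℂ 2 ![b.coord 0, b.coord 1]))

theorem minorCoord_map {m : ℕ} (b : Module.Basis (Fin 2) ℂ V₂) (c : Module.Basis (Fin m) ℂ V₃)
    (g : Module.Dual ℂ V₂ →ₗ[ℂ] V₃) (k l : Fin m) :
    minorCoord b c (exteriorPower.map 2 g) k l =
      c.coord k (g (b.coord 0)) * c.coord l (g (b.coord 1)) -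
        c.coord l (g (b.coord 0)) * c.coord k (g (b.coord 1)) := by
  rw [minorCoord, exteriorPower.map_apply_ιMulti, exteriorPower.pairingDual_ιMulti_ιMulti,
    Matrix.det_fin_two]
  simp

/-- `Λ² V₂*` is a line spanned by `b₀* ∧ b₁*`, so an element of the space is determined by one
value, whose coordinates in the induced basis of `Λ² V₃` are among the given numbers. -/
theorem minorCoord_ext {m : ℕ} (b : Module.Basis (Fin 2) ℂ V₂) (c : Module.Basis (Fin m) ℂ V₃)
    {L L' : MinorSpace 2 V₂ V₃} (h : ∀ k l, minorCoord b c L k l = minorCoord b c L' k l) :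
    L = L' := by
  have h01 : L (exteriorPower.ιMulti ℂ 2 ![b.coord 0, b.coord 1]) =
      L' (exteriorPower.ιMulti ℂ 2 ![b.coord 0, b.coord 1]) := by
    refine (c.exteriorPower 2).ext_elem fun s => ?_
    rw [exteriorPower.basis_repr_apply, exteriorPower.basis_repr_apply]
    have := h (Set.powersetCard.ofFinEmbEquiv.symm s 0) (Set.powersetCard.ofFinEmbEquiv.symm s 1)
    rw [minorCoord, minorCoord] at this
    have e : ![c.coord (Set.powersetCard.ofFinEmbEquiv.symm s 0),
        c.coord (Set.powersetCard.ofFinEmbEquiv.symm s 1)] =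
        c.coord ∘ (Set.powersetCard.ofFinEmbEquiv.symm s) := by
      ext i; fin_cases i <;> rfl
    rw [e] at this
    exact this
  refine exteriorPower.linearMap_ext (Module.Basis.ext_alternating b.dualBasis fun v hv => ?_)
  have hv01 : v 0 ≠ v 1 := fun h => by simpa using hv h
  have hb : ∀ i, b.dualBasis i = b.coord i := fun i => by simp
  simp only [LinearMap.compAlternatingMap_apply, hb]
  have h10 : (exteriorPower.ιMulti ℂ 2) ![b.coord 1, b.coord 0] =
      -(exteriorPower.ιMulti ℂ 2) ![b.coord 0, b.coord 1] := by
    rw [← AlternatingMap.map_swap _ _ (i := 0) (j := 1) (by decide)]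
    congr 1
    ext i; fin_cases i <;> rfl
  rcases (show (v 0 = 0 ∧ v 1 = 1) ∨ (v 0 = 1 ∧ v 1 = 0) by omega) with ⟨e0, e1⟩ | ⟨e0, e1⟩
  · have e : (fun i => b.coord (v i)) = ![b.coord 0, b.coord 1] := by
      ext i; fin_cases i <;> simp [e0, e1]
    rw [e, h01]
  · have e : (fun i => b.coord (v i)) = ![b.coord 1, b.coord 0] := by
      ext i; fin_cases i <;> simp [e0, e1]
    rw [e, h10, map_neg, map_neg, h01]

/-- The linear map `V₂* → V₃` of rank two with `b₀* ↦ c_k` and `b₁* ↦ c_l`. -/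
def unitHom {m : ℕ} (b : Module.Basis (Fin 2) ℂ V₂) (c : Module.Basis (Fin m) ℂ V₃)
    (k l : Fin m) : Module.Dual ℂ V₂ →ₗ[ℂ] V₃ :=
  (Module.Dual.eval ℂ V₂ (b 0)).smulRight (c k) + (Module.Dual.eval ℂ V₂ (b 1)).smulRight (c l)

/-- The element of `Hom(Λ² V₂*, Λ² V₃)` with `b₀* ∧ b₁* ↦ ∑ Mₖₗ c_k ∧ c_l`. -/
def ofMinors {m : ℕ} (b : Module.Basis (Fin 2) ℂ V₂) (c : Module.Basis (Fin m) ℂ V₃) :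
    Matrix (Fin m) (Fin m) ℂ →ₗ[ℂ] MinorSpace 2 V₂ V₃ where
  toFun M := ∑ k, ∑ l, M k l • exteriorPower.map 2 (unitHom b c k l)
  map_add' M M' := by simp [add_smul, Finset.sum_add_distrib]
  map_smul' r M := by simp [mul_smul, Finset.smul_sum]

/-- Only the antisymmetric part of `M` survives, because `c_k ∧ c_l` changes sign. This permits
storing each minor once, above the diagonal. -/
theorem minorCoord_ofMinors {m : ℕ} (b : Module.Basis (Fin 2) ℂ V₂)
    (c : Module.Basis (Fin m) ℂ V₃) (M : Matrix (Fin m) (Fin m) ℂ) (k l : Fin m) :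
    minorCoord b c (ofMinors b c M) k l = M k l - M l k := by
  have h : ∀ i j, minorCoord b c (exteriorPower.map 2 (unitHom b c i j)) k l =
      (if i = k then 1 else 0) * (if j = l then 1 else 0) -
        (if i = l then 1 else 0) * (if j = k then 1 else 0) := by
    intro i j
    rw [minorCoord_map]
    simp [unitHom, Finsupp.single_apply]
  have h' : minorCoord b c (ofMinors b c M) k l =
      ∑ i, ∑ j, M i j * minorCoord b c (exteriorPower.map 2 (unitHom b c i j)) k l := by
    simp [minorCoord, ofMinors]
  rw [h']
  simp only [h, mul_sub, Finset.sum_sub_distrib]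
  congr 1 <;> simp

theorem toHom_flattening₁ {m : ℕ} {N : (Fin 3 → ℂ) → Matrix (Fin 2) (Fin m) ℂ}
    (hN : ∀ x j k, N x j k = ∑ i, x i * N (Pi.single i 1) j k) (a : Fin 3 → V₁) (b : Fin 2 → V₂)
    (c : Fin m → V₃) (φ : Module.Dual ℂ V₁) (ψ : Module.Dual ℂ V₂) :
    toHom (flattening₁
      (∑ i, ∑ j, ∑ k, N (Pi.single i 1) j k • (a i ⊗ₜ[ℂ] (b j ⊗ₜ[ℂ] c k))) φ) ψ =
      ∑ k, (∑ j, ψ (b j) * N (fun i => φ (a i)) j k) • c k := by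
  change contractFst ψ (contractFst φ _) = _
  simp only [map_sum, map_smul, contractFst_tmul]
  rw [Finset.sum_comm]
  simp_rw [Finset.sum_comm (s := Finset.univ (α := Fin 3)), hN (fun i => φ (a i)), Finset.mul_sum,
    Finset.sum_smul]
  rw [Finset.sum_comm]
  refine Finset.sum_congr rfl fun k _ => Finset.sum_congr rfl fun j _ =>
    Finset.sum_congr rfl fun i _ => ?_
  rw [smul_smul, smul_smul]
  congr 1
  ring

/-- If the minors of `N` are a linear function of the values of `q`, then the collineation variety
of a tensor with normal form `N` is a copy of the closure of the image of `q`. -/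
theorem HasNormalForm.isLinearCopy {m d : ℕ} {N : (Fin 3 → ℂ) → Matrix (Fin 2) (Fin m) ℂ}
    {T : V₁ ⊗[ℂ] (V₂ ⊗[ℂ] V₃)} (h : HasNormalForm T N)
    (hN : ∀ x j k, N x j k = ∑ i, x i * N (Pi.single i 1) j k)
    {P : (Fin d → ℂ) → Matrix (Fin m) (Fin m) ℂ} {q : (Fin 3 → ℂ) → Fin d → ℂ}
    {Y : Set (ℙ ℂ (Fin d → ℂ))}
    (hPadd : ∀ z w, P (z + w) = P z + P w) (hPsmul : ∀ (r : ℂ) z, P (r • z) = r • P z)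
    (hPinj : ∀ z, (∀ k l, P z k l = P z l k) → z = 0)
    (hq : ∀ x k l, N x 0 k * N x 1 l - N x 0 l * N x 1 k = P (q x) k l - P (q x) l k)
    (hY : zariskiClosure Y ⊆ Y)
    (hqY : ∀ x, ∀ h : q x ≠ 0, Projectivization.mk ℂ (q x) h ∈ Y)
    (hd : ∀ v, ∀ h : v ≠ 0, Projectivization.mk ℂ v h ∈ Y → v ∈ closure (valueCone q)) :
    IsLinearCopy (collineationVariety 2 T) Y := by
  obtain ⟨a, b, c, rfl⟩ := h
  let f : (Fin d → ℂ) →ₗ[ℂ] MinorSpace 2 V₂ V₃ :=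
    ofMinors b c ∘ₗ { toFun := P, map_add' := hPadd, map_smul' := hPsmul }
  have hf : ∀ z k l, minorCoord b c (f z) k l = P z k l - P z l k :=
    fun z k l => minorCoord_ofMinors b c _ k l
  -- The kernel of `ofMinors` consists of symmetric matrices, which is what `hPinj` excludes for
  -- nonzero `z`.
  have hinj : Function.Injective f := by
    rw [injective_iff_map_eq_zero]
    intro z hz
    refine hPinj z fun k l => ?_
    have := hf z k l
    rw [hz] at this
    simpa [minorCoord, sub_eq_zero, eq_comm] using this
  have hmin : ∀ φ : Module.Dual ℂ V₁, minorMap 2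
      (∑ i, ∑ j, ∑ k, N (Pi.single i 1) j k • (a i ⊗ₜ[ℂ] (b j ⊗ₜ[ℂ] c k))) φ =
      f (q fun i => φ (a i)) := by
    intro φ
    refine minorCoord_ext b c fun k l => ?_
    rw [hf, ← hq, minorMap, minorCoord_map, toHom_flattening₁ hN, toHom_flattening₁ hN]
    simp [Finsupp.single_apply]
  refine isLinearCopy_of_parametrization q f hinj hY ?_ hqY hd
  intro p
  constructor
  · rintro ⟨φ, h, rfl⟩
    refine ⟨fun i => φ (a i), by rwa [← hmin], ?_⟩
    congr 1
    exact hmin φ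
  · rintro ⟨x, h, rfl⟩
    -- Every point of `ℂ³` is the vector of values of some linear form on the basis `a`, so the
    -- whole parametrization by `x` is reached.
    have hx : (fun i => a.constr ℂ x (a i)) = x := by
      funext i; simp
    have hm := hmin (a.constr ℂ x)
    rw [hx] at hm
    refine ⟨a.constr ℂ x, by rwa [hm], ?_⟩
    congr 1
    exact hm.symm

end Minors

/-! ### Density of the quadratic parametrizations -/

section Parametrizations

open Filter Topology

theorem mem_valueCone_of_eq {ι : Type*} {n : ℕ} {q : ι → Fin n → ℂ} {w : Fin n → ℂ} {c : ℂ} (x : ι)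
    (hc : c ≠ 0) (hw : w ≠ 0) (h : q x = c • w) : w ∈ valueCone q :=
  ⟨hw, c, hc, x, h⟩

theorem zariskiClosure_univ_subset {E : Type*} [AddCommGroup E] [Module ℂ E] :
    zariskiClosure (Set.univ : Set (ℙ ℂ E)) ⊆ Set.univ :=
  Set.subset_univ _

/-- A set containing all vectors with nonzero coordinates is dense. -/
theorem mem_closure_of_forall_coord_ne_zero {n : ℕ} {D : Set (Fin n → ℂ)}
    (h : ∀ w : Fin n → ℂ, (∀ i, w i ≠ 0) → w ∈ D) (v : Fin n → ℂ) : v ∈ closure D := by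
  have hv : Continuous fun t : ℂ => v + fun _ => t := by fun_prop
  have := mem_closure_of_curve (D := D) hv ?_
  · convert this using 1
    ext i; simp
  · have : ∀ᶠ t in 𝓝[≠] (0 : ℂ), ∀ i, v i + t ≠ 0 :=
      eventually_all.2 fun i => eventually_add_ne_zero (v i)
    filter_upwards [this] with t ht
    exact h _ ht

theorem ne_zero_of_apply_ne_zero {n : ℕ} {w : Fin n → ℂ} (i : Fin n) (h : w i ≠ 0) : w ≠ 0 := by
  rintro rfl
  exact h rfl

/-- The parametrization `x ↦ (x₀² : x₀x₁ : x₁² : x₀x₂)` of the quadric cone. -/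
def quadricConeMap (x : Fin 3 → ℂ) : Fin 4 → ℂ := ![x 0 ^ 2, x 0 * x 1, x 1 ^ 2, x 0 * x 2]

/-- The parametrization `x ↦ (x₀² : x₀x₁ : x₀x₂ : x₁x₂)` of the smooth quadric. -/
def smoothQuadricMap (x : Fin 3 → ℂ) : Fin 4 → ℂ := ![x 0 ^ 2, x 0 * x 1, x 0 * x 2, x 1 * x 2]

/-- The parametrization `x ↦ (x₂x₀ : x₂x₁ : x₀² : x₀x₁ : x₁²)` of the cubic scroll. -/
def cubicScrollMap (x : Fin 3 → ℂ) : Fin 5 → ℂ :=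
  ![x 2 * x 0, x 2 * x 1, x 0 ^ 2, x 0 * x 1, x 1 ^ 2]

/-- The second Veronese map of the plane. -/
def veroneseMap (x : Fin 3 → ℂ) : Fin 6 → ℂ :=
  ![x 0 ^ 2, x 0 * x 1, x 0 * x 2, x 1 ^ 2, x 1 * x 2, x 2 ^ 2]

/-- On the chart `w₀ ≠ 0` the parametrization is inverted by a coordinate projection, up to the
factor `w₀`. -/
theorem mem_valueCone_quadricConeMap {w : Fin 4 → ℂ} (h : w 0 * w 2 = w 1 ^ 2) (h0 : w 0 ≠ 0) :
    w ∈ valueCone quadricConeMap := by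
  refine mem_valueCone_of_eq ![w 0, w 1, w 3] h0 (ne_zero_of_apply_ne_zero 0 h0) ?_
  ext i; fin_cases i <;> simp [quadricConeMap, pow_two]
  linear_combination -h

/-- The chart misses only the ruling `v₀ = v₁ = 0`. Each of its points is the limit at `t = 0` of an
explicit curve on the cone whose first coordinate vanishes only at `t = 0`. -/
theorem mem_closure_quadricConeMap {v : Fin 4 → ℂ} (h : v 0 * v 2 = v 1 ^ 2) :
    v ∈ closure (valueCone quadricConeMap) := by
  by_cases h0 : v 0 = 0
  · have h1 : v 1 = 0 := by
      rw [h0, zero_mul] at h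
      exact pow_eq_zero_iff two_ne_zero |>.1 h.symm
    by_cases h2 : v 2 = 0
    · have hc : Continuous fun t : ℂ => ![t, 0, 0, v 3] := by fun_prop
      convert mem_closure_of_curve (D := valueCone quadricConeMap) hc ?_ using 1
      · ext i; fin_cases i <;> simp [h0, h1, h2]
      · filter_upwards [self_mem_nhdsWithin] with t ht
        exact mem_valueCone_quadricConeMap (by simp) (by simpa using ht)
    · have hc : Continuous fun t : ℂ => ![t ^ 2 * v 2, t * v 2, v 2, v 3] := by fun_prop
      convert mem_closure_of_curve (D := valueCone quadricConeMap) hc ?_ using 1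
      · ext i; fin_cases i <;> simp [h0, h1]
      · filter_upwards [self_mem_nhdsWithin] with t ht
        exact mem_valueCone_quadricConeMap (by simp; ring)
          (by simpa using mul_ne_zero (pow_ne_zero 2 ht) h2)
  · exact subset_closure (mem_valueCone_quadricConeMap h h0)

theorem mem_valueCone_smoothQuadricMap {w : Fin 4 → ℂ} (h : w 0 * w 3 = w 1 * w 2)
    (h0 : w 0 ≠ 0) : w ∈ valueCone smoothQuadricMap := by
  refine mem_valueCone_of_eq ![w 0, w 1, w 2] h0 (ne_zero_of_apply_ne_zero 0 h0) ?_
  ext i; fin_cases i <;> simp [smoothQuadricMap, pow_two]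
  linear_combination -h

/-- The chart `v₀ ≠ 0` misses two lines, `v₁ = 0` and `v₂ = 0` in the tangent plane `v₀ = 0`; the
three curves approach their intersection point and the remaining points of either line. -/
theorem mem_closure_smoothQuadricMap {v : Fin 4 → ℂ} (h : v 0 * v 3 = v 1 * v 2) :
    v ∈ closure (valueCone smoothQuadricMap) := by
  by_cases h0 : v 0 = 0
  · rw [h0, zero_mul, eq_comm, mul_eq_zero] at h
    by_cases h1 : v 1 = 0
    · by_cases h2 : v 2 = 0
      · have hc : Continuous fun t : ℂ => ![t ^ 2, t * v 3, t, v 3] := by fun_prop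
        convert mem_closure_of_curve (D := valueCone smoothQuadricMap) hc ?_ using 1
        · ext i; fin_cases i <;> simp [h0, h1, h2]
        · filter_upwards [self_mem_nhdsWithin] with t ht
          exact mem_valueCone_smoothQuadricMap (by simp; ring) (by simpa using ht)
      · have hc : Continuous fun t : ℂ => ![t * v 2, t * v 3, v 2, v 3] := by fun_prop
        convert mem_closure_of_curve (D := valueCone smoothQuadricMap) hc ?_ using 1
        · ext i; fin_cases i <;> simp [h0, h1]
        · filter_upwards [self_mem_nhdsWithin] with t ht
          exact mem_valueCone_smoothQuadricMap (by simp; ring) (by simpa using ⟨ht, h2⟩)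
    · have h2 : v 2 = 0 := h.resolve_left h1
      have hc : Continuous fun t : ℂ => ![t * v 1, v 1, t * v 3, v 3] := by fun_prop
      convert mem_closure_of_curve (D := valueCone smoothQuadricMap) hc ?_ using 1
      · ext i; fin_cases i <;> simp [h0, h2]
      · filter_upwards [self_mem_nhdsWithin] with t ht
        exact mem_valueCone_smoothQuadricMap (by simp; ring) (by simpa using ⟨ht, h1⟩)
  · exact subset_closure (mem_valueCone_smoothQuadricMap h h0)

theorem mem_valueCone_cubicScrollMap {s t u w : ℂ} (ht : t ≠ 0)
    (h : ![s * u, s * w, t * u ^ 2, t * (u * w), t * w ^ 2] ≠ 0) :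
    ![s * u, s * w, t * u ^ 2, t * (u * w), t * w ^ 2] ∈ valueCone cubicScrollMap := by
  refine mem_valueCone_of_eq ![u, w, s / t] (inv_ne_zero ht) h ?_
  ext i; fin_cases i <;> simp [cubicScrollMap] <;> field_simp

/-- The parametrization reaches the points with `t ≠ 0`; the directrix `t = 0` is approached by
replacing `t` with `t + r`. -/
theorem mem_closure_cubicScrollMap {v : Fin 5 → ℂ} (hv : v ≠ 0)
    (h : ∃ s t u w : ℂ, v = ![s * u, s * w, t * u ^ 2, t * (u * w), t * w ^ 2]) :
    v ∈ closure (valueCone cubicScrollMap) := by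
  obtain ⟨s, t, u, w, rfl⟩ := h
  have hc : Continuous fun r : ℂ => ![s * u, s * w, (t + r) * u ^ 2, (t + r) * (u * w),
    (t + r) * w ^ 2] := by fun_prop
  convert mem_closure_of_curve (D := valueCone cubicScrollMap) hc ?_ using 1
  · simp
  · filter_upwards [eventually_add_ne_zero t] with r hr
    -- If the perturbed vector vanished, its conic part would force `u = w = 0`, and then the
    -- original vector would vanish as well.
    refine mem_valueCone_cubicScrollMap hr fun h0 => hv ?_
    have h2 := congrFun h0 2
    have h4 := congrFun h0 4
    simp [hr] at h2 h4
    simp [h2, h4]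

theorem mem_closure_veroneseMap {v : Fin 6 → ℂ} (hv : v ≠ 0)
    (h : ∃ x y z : ℂ, v = ![x ^ 2, x * y, x * z, y ^ 2, y * z, z ^ 2]) :
    v ∈ closure (valueCone veroneseMap) := by
  obtain ⟨x, y, z, rfl⟩ := h
  refine subset_closure (mem_valueCone_of_eq ![x, y, z] one_ne_zero hv ?_)
  simp [veroneseMap]

end Parametrizations

/-! ### The collineation variety of each normal form -/

section NormalFormVarieties

variable {V₁ V₂ V₃ : Type*} [AddCommGroup V₁] [Module ℂ V₁] [AddCommGroup V₂] [Module ℂ V₂]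
  [AddCommGroup V₃] [Module ℂ V₃] {T : V₁ ⊗[ℂ] (V₂ ⊗[ℂ] V₃)}

/-- Here and below `q` lists a basis of the span of the minors, and the strictly upper triangular
`P` expresses every minor in it. The variable `x₁` does not occur in the minors of this form, so the
preimage of a generic point sets it to zero. -/
theorem isLinearCopy_of_netJ2J1 (h : HasNormalForm T netJ2J1) :
    IsLinearCopy (collineationVariety 2 T) projLine := by
  refine h.isLinearCopy (q := fun x => ![x 0 ^ 2, x 0 * x 2]) (P := fun z => !![
      0, z 0, 0;
      0, 0, -z 1;
      0, 0, 0])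
    (by intro x j k; fin_cases j <;> fin_cases k <;> simp [netJ2J1, Fin.sum_univ_three])
    (by intro z w; ext k l; fin_cases k <;> fin_cases l <;> simp <;> ring)
    (by intro r z; ext k l; fin_cases k <;> fin_cases l <;> simp)
    (by
      intro z h
      ext i; fin_cases i
      exacts [by simpa using h 0 1, by simpa using h 1 2])
    (by intro x k l; fin_cases k <;> fin_cases l <;> simp [netJ2J1] <;> ring)
    zariskiClosure_univ_subset
    (fun _ _ => Set.mem_univ _) ?_
  intro v _ _
  refine mem_closure_of_forall_coord_ne_zero (fun w hw => ?_) v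
  refine mem_valueCone_of_eq (c := w 0) ![w 0, 0, w 1] (hw 0)
    (ne_zero_of_apply_ne_zero 0 (hw 0)) ?_
  have h0 := hw 0
  have h1 := hw 1
  ext i; fin_cases i <;> simp <;> field_simp

theorem isLinearCopy_of_netJ1J1J1' (h : HasNormalForm T netJ1J1J1') :
    IsLinearCopy (collineationVariety 2 T) projLine := by
  refine h.isLinearCopy (q := fun x => ![x 0 * x 2, x 1 * x 2]) (P := fun z => !![
      0, 0, z 0;
      0, 0, z 1;
      0, 0, 0])
    (by intro x j k; fin_cases j <;> fin_cases k <;> simp [netJ1J1J1', Fin.sum_univ_three])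
    (by intro z w; ext k l; fin_cases k <;> fin_cases l <;> simp)
    (by intro r z; ext k l; fin_cases k <;> fin_cases l <;> simp)
    (by
      intro z h
      ext i; fin_cases i
      exacts [by simpa using h 0 2, by simpa using h 1 2])
    (by intro x k l; fin_cases k <;> fin_cases l <;> simp [netJ1J1J1'])
    zariskiClosure_univ_subset
    (fun _ _ => Set.mem_univ _) ?_
  intro v _ _
  refine mem_closure_of_forall_coord_ne_zero (fun w hw => ?_) v
  refine mem_valueCone_of_eq (c := 1) ![w 0, w 1, 1] (one_ne_zero)
    (ne_zero_of_apply_ne_zero 0 (hw 0)) ?_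
  have h0 := hw 0
  have h1 := hw 1
  ext i; fin_cases i <;> simp

theorem isLinearCopy_of_netL1R1 (h : HasNormalForm T netL1R1) :
    IsLinearCopy (collineationVariety 2 T) projPlane := by
  refine h.isLinearCopy (q := fun x => ![x 0 ^ 2, x 0 * x 1, x 0 * x 2]) (P := fun z => !![
      0, z 0, z 2;
      0, 0, -z 1;
      0, 0, 0])
    (by intro x j k; fin_cases j <;> fin_cases k <;> simp [netL1R1, Fin.sum_univ_three])
    (by intro z w; ext k l; fin_cases k <;> fin_cases l <;> simp <;> ring)
    (by intro r z; ext k l; fin_cases k <;> fin_cases l <;> simp)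
    (by
      intro z h
      ext i; fin_cases i
      exacts [by simpa using h 0 1, by simpa using h 1 2, by simpa using h 0 2])
    (by intro x k l; fin_cases k <;> fin_cases l <;> simp [netL1R1] <;> ring)
    zariskiClosure_univ_subset
    (fun _ _ => Set.mem_univ _) ?_
  intro v _ _
  refine mem_closure_of_forall_coord_ne_zero (fun w hw => ?_) v
  refine mem_valueCone_of_eq (c := w 0) w (hw 0)
    (ne_zero_of_apply_ne_zero 0 (hw 0)) ?_
  have h0 := hw 0
  have h1 := hw 1
  ext i; fin_cases i <;> simp <;> field_simp

theorem isLinearCopy_of_netJ3 (h : HasNormalForm T netJ3) :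
    IsLinearCopy (collineationVariety 2 T) projPlane := by
  refine h.isLinearCopy (q := fun x => ![x 0 ^ 2, x 0 * x 1, x 1 ^ 2 - x 0 * x 2]) (P := fun z => !![
      0, z 0, z 1;
      0, 0, z 2;
      0, 0, 0])
    (by intro x j k; fin_cases j <;> fin_cases k <;> simp [netJ3, Fin.sum_univ_three])
    (by intro z w; ext k l; fin_cases k <;> fin_cases l <;> simp)
    (by intro r z; ext k l; fin_cases k <;> fin_cases l <;> simp)
    (by
      intro z h
      ext i; fin_cases i
      exacts [by simpa using h 0 1, by simpa using h 0 2, by simpa using h 1 2])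
    (by intro x k l; fin_cases k <;> fin_cases l <;> simp [netJ3] <;> ring)
    zariskiClosure_univ_subset
    (fun _ _ => Set.mem_univ _) ?_
  intro v _ _
  refine mem_closure_of_forall_coord_ne_zero (fun w hw => ?_) v
  -- The third minor is linear in `x₂`, so `x₁² - x₀x₂ = w₀w₂` is solved for `x₂`.
  refine mem_valueCone_of_eq (c := w 0) ![w 0, w 1, (w 1 ^ 2 - w 0 * w 2) / w 0] (hw 0)
    (ne_zero_of_apply_ne_zero 0 (hw 0)) ?_
  have h0 := hw 0
  have h1 := hw 1
  ext i; fin_cases i <;> simp <;> field_simp <;> ring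

theorem isLinearCopy_of_netJ2J1' (h : HasNormalForm T netJ2J1') :
    IsLinearCopy (collineationVariety 2 T) projPlane := by
  refine h.isLinearCopy (q := fun x => ![x 0 ^ 2, x 0 * x 2, x 1 * x 2]) (P := fun z => !![
      0, z 0, z 1;
      0, 0, z 2;
      0, 0, 0])
    (by intro x j k; fin_cases j <;> fin_cases k <;> simp [netJ2J1', Fin.sum_univ_three])
    (by intro z w; ext k l; fin_cases k <;> fin_cases l <;> simp)
    (by intro r z; ext k l; fin_cases k <;> fin_cases l <;> simp)
    (by
      intro z h
      ext i; fin_cases i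
      exacts [by simpa using h 0 1, by simpa using h 0 2, by simpa using h 1 2])
    (by intro x k l; fin_cases k <;> fin_cases l <;> simp [netJ2J1'] <;> ring)
    zariskiClosure_univ_subset
    (fun _ _ => Set.mem_univ _) ?_
  intro v _ _
  refine mem_closure_of_forall_coord_ne_zero (fun w hw => ?_) v
  refine mem_valueCone_of_eq (c := w 0) ![w 0, w 0 * w 2 / w 1, w 1] (hw 0)
    (ne_zero_of_apply_ne_zero 0 (hw 0)) ?_
  have h0 := hw 0
  have h1 := hw 1
  ext i; fin_cases i <;> simp <;> field_simp

theorem isLinearCopy_of_netJ1J1'J1'' (h : HasNormalForm T netJ1J1'J1'') :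
    IsLinearCopy (collineationVariety 2 T) projPlane := by
  refine h.isLinearCopy (q := fun x => ![x 0 * x 1, x 0 * x 2, x 1 * x 2]) (P := fun z => !![
      0, z 0, z 1;
      0, 0, -z 2;
      0, 0, 0])
    (by intro x j k; fin_cases j <;> fin_cases k <;> simp [netJ1J1'J1'', Fin.sum_univ_three])
    (by intro z w; ext k l; fin_cases k <;> fin_cases l <;> simp <;> ring)
    (by intro r z; ext k l; fin_cases k <;> fin_cases l <;> simp)
    (by
      intro z h
      ext i; fin_cases i
      exacts [by simpa using h 0 1, by simpa using h 0 2, by simpa using h 1 2])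
    (by intro x k l; fin_cases k <;> fin_cases l <;> simp [netJ1J1'J1''] <;> ring)
    zariskiClosure_univ_subset
    (fun _ _ => Set.mem_univ _) ?_
  intro v _ _
  refine mem_closure_of_forall_coord_ne_zero (fun w hw => ?_) v
  -- Here `q` is the standard quadratic Cremona transformation in permuted coordinates, and `q (q w)
  -- = w₀w₁w₂ • w`.
  refine mem_valueCone_of_eq (c := w 0 * w 1 * w 2) ![w 0 * w 1, w 0 * w 2, w 1 * w 2]
    (mul_ne_zero (mul_ne_zero (hw 0) (hw 1)) (hw 2))
    (ne_zero_of_apply_ne_zero 0 (hw 0)) ?_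
  have h0 := hw 0
  have h1 := hw 1
  ext i; fin_cases i <;> simp <;> field_simp

theorem isLinearCopy_of_netL1J1J1 (h : HasNormalForm T netL1J1J1) :
    IsLinearCopy (collineationVariety 2 T) projPlane := by
  refine h.isLinearCopy (q := fun x => ![x 0 ^ 2, x 0 * x 1, x 0 * x 2]) (P := fun z => !![
      0, z 0, 0, 0;
      0, 0, -z 1, -z 2;
      0, 0, 0, 0;
      0, 0, 0, 0])
    (by intro x j k; fin_cases j <;> fin_cases k <;> simp [netL1J1J1, Fin.sum_univ_three])
    (by intro z w; ext k l; fin_cases k <;> fin_cases l <;> simp <;> ring)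
    (by intro r z; ext k l; fin_cases k <;> fin_cases l <;> simp)
    (by
      intro z h
      ext i; fin_cases i
      exacts [by simpa using h 0 1, by simpa using h 1 2, by simpa using h 1 3])
    (by intro x k l; fin_cases k <;> fin_cases l <;> simp [netL1J1J1] <;> ring)
    zariskiClosure_univ_subset
    (fun _ _ => Set.mem_univ _) ?_
  intro v _ _
  refine mem_closure_of_forall_coord_ne_zero (fun w hw => ?_) v
  refine mem_valueCone_of_eq (c := w 0) w (hw 0)
    (ne_zero_of_apply_ne_zero 0 (hw 0)) ?_
  have h0 := hw 0
  have h1 := hw 1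
  ext i; fin_cases i <;> simp <;> field_simp

/-- The minors span the conics through `(0 : 0 : 1)` that are tangent there to `x₀ = 0` (or
singular). -/
theorem isLinearCopy_of_netL1J2 (h : HasNormalForm T netL1J2) :
    IsLinearCopy (collineationVariety 2 T) quadricCone := by
  refine h.isLinearCopy (q := quadricConeMap) (P := fun z => !![
      0, z 0, 0, z 1;
      0, 0, -z 1, -z 3;
      0, 0, 0, z 2;
      0, 0, 0, 0])
    (by intro x j k; fin_cases j <;> fin_cases k <;> simp [netL1J2, Fin.sum_univ_three])
    (by intro z w; ext k l; fin_cases k <;> fin_cases l <;> simp <;> ring)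
    (by intro r z; ext k l; fin_cases k <;> fin_cases l <;> simp)
    (by
      intro z h
      ext i; fin_cases i
      exacts [by simpa using h 0 1, by simpa using h 0 3,
        by simpa using h 2 3, by simpa using h 1 3])
    (by intro x k l; fin_cases k <;> fin_cases l <;> simp [netL1J2, quadricConeMap] <;> ring)
    zariskiClosure_quadricCone
    (fun x h => (mk_mem_quadricCone h).2 (by simp [quadricConeMap]; ring)) fun v hv h =>
      mem_closure_quadricConeMap ((mk_mem_quadricCone hv).1 h)

/-- The minors span the conics through the two points `(0 : 1 : 0)` and `(0 : 0 : 1)`. -/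
theorem isLinearCopy_of_netL1J1J1' (h : HasNormalForm T netL1J1J1') :
    IsLinearCopy (collineationVariety 2 T) smoothQuadric := by
  refine h.isLinearCopy (q := smoothQuadricMap) (P := fun z => !![
      0, z 0, 0, z 2;
      0, 0, -z 1, 0;
      0, 0, 0, z 3;
      0, 0, 0, 0])
    (by intro x j k; fin_cases j <;> fin_cases k <;> simp [netL1J1J1', Fin.sum_univ_three])
    (by intro z w; ext k l; fin_cases k <;> fin_cases l <;> simp <;> ring)
    (by intro r z; ext k l; fin_cases k <;> fin_cases l <;> simp)
    (by
      intro z h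
      ext i; fin_cases i
      exacts [by simpa using h 0 1, by simpa using h 1 2,
        by simpa using h 0 3, by simpa using h 2 3])
    (by intro x k l; fin_cases k <;> fin_cases l <;> simp [netL1J1J1', smoothQuadricMap] <;> ring)
    zariskiClosure_smoothQuadric
    (fun x h => (mk_mem_smoothQuadric h).2 (by simp [smoothQuadricMap]; ring)) fun v hv h =>
      mem_closure_smoothQuadricMap ((mk_mem_smoothQuadric hv).1 h)

/-- The minors span the conics through `(0 : 0 : 1)`: every quadratic monomial except `x₂²` occurs.
-/
theorem isLinearCopy_of_netL2J1 (h : HasNormalForm T netL2J1) :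
    IsLinearCopy (collineationVariety 2 T) cubicScroll := by
  refine h.isLinearCopy (q := cubicScrollMap) (P := fun z => !![
      0, z 2, z 3, 0;
      0, 0, z 4, -z 0;
      0, 0, 0, -z 1;
      0, 0, 0, 0])
    (by intro x j k; fin_cases j <;> fin_cases k <;> simp [netL2J1, Fin.sum_univ_three])
    (by intro z w; ext k l; fin_cases k <;> fin_cases l <;> simp <;> ring)
    (by intro r z; ext k l; fin_cases k <;> fin_cases l <;> simp)
    (by
      intro z h
      ext i; fin_cases i
      exacts [by simpa using h 1 3, by simpa using h 2 3,
        by simpa using h 0 1, by simpa using h 0 2, by simpa using h 1 2])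
    (by intro x k l; fin_cases k <;> fin_cases l <;> simp [netL2J1, cubicScrollMap] <;> ring)
    zariskiClosure_cubicScroll
    (fun x h => (mk_mem_cubicScroll h).2 ((cubicScroll_iff _).1
      ⟨x 2, 1, x 0, x 1, by simp [cubicScrollMap]⟩)) fun v hv h =>
      mem_closure_cubicScrollMap hv ((cubicScroll_iff v).2 ((mk_mem_cubicScroll hv).1 h))

theorem isLinearCopy_of_netL1L1J1 (h : HasNormalForm T netL1L1J1) :
    IsLinearCopy (collineationVariety 2 T) cubicScroll := by
  refine h.isLinearCopy (q := cubicScrollMap) (P := fun z => !![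
      0, z 2, 0, z 3, 0;
      0, 0, -z 3, 0, -z 0;
      0, 0, 0, z 4, 0;
      0, 0, 0, 0, -z 1;
      0, 0, 0, 0, 0])
    (by intro x j k; fin_cases j <;> fin_cases k <;> simp [netL1L1J1, Fin.sum_univ_three])
    (by intro z w; ext k l; fin_cases k <;> fin_cases l <;> simp <;> ring)
    (by intro r z; ext k l; fin_cases k <;> fin_cases l <;> simp)
    (by
      intro z h
      ext i; fin_cases i
      exacts [by simpa using h 1 4, by simpa using h 3 4,
        by simpa using h 0 1, by simpa using h 0 3, by simpa using h 2 3])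
    (by intro x k l; fin_cases k <;> fin_cases l <;> simp [netL1L1J1, cubicScrollMap] <;> ring)
    zariskiClosure_cubicScroll
    (fun x h => (mk_mem_cubicScroll h).2 ((cubicScroll_iff _).1
      ⟨x 2, 1, x 0, x 1, by simp [cubicScrollMap]⟩)) fun v hv h =>
      mem_closure_cubicScrollMap hv ((cubicScroll_iff v).2 ((mk_mem_cubicScroll hv).1 h))

/-- The six minors form a basis of all conics. Only `x₁² - x₀x₂` is not a monomial, hence the entry
`z₃ - z₂`, and injectivity must establish `z₂ = 0` before `z₃ = 0`. -/
theorem isLinearCopy_of_netL3 (h : HasNormalForm T netL3) :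
    IsLinearCopy (collineationVariety 2 T) veroneseSurface := by
  refine h.isLinearCopy (q := veroneseMap) (P := fun z => !![
      0, z 0, z 1, z 2;
      0, 0, z 3 - z 2, z 4;
      0, 0, 0, z 5;
      0, 0, 0, 0])
    (by intro x j k; fin_cases j <;> fin_cases k <;> simp [netL3, Fin.sum_univ_three])
    (by intro z w; ext k l; fin_cases k <;> fin_cases l <;> simp <;> ring)
    (by intro r z; ext k l; fin_cases k <;> fin_cases l <;> simp <;> ring)
    (by
      intro z h
      have h2 : z 2 = 0 := by simpa using h 0 3
      ext i; fin_cases i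
      exacts [by simpa using h 0 1, by simpa using h 0 2, h2, by simpa [h2] using h 1 2,
        by simpa using h 1 3, by simpa using h 2 3])
    (by intro x k l; fin_cases k <;> fin_cases l <;> simp [netL3, veroneseMap] <;> ring)
    zariskiClosure_veroneseSurface
    (fun x h => (mk_mem_veroneseSurface h).2 ((veroneseSurface_iff _).1
      ⟨x 0, x 1, x 2, rfl⟩)) fun v hv h =>
      mem_closure_veroneseMap hv ((veroneseSurface_iff v).2 ((mk_mem_veroneseSurface hv).1 h))

theorem isLinearCopy_of_netL1L2 (h : HasNormalForm T netL1L2) :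
    IsLinearCopy (collineationVariety 2 T) veroneseSurface := by
  refine h.isLinearCopy (q := veroneseMap) (P := fun z => !![
      0, z 0, 0, z 1, z 2;
      0, 0, -z 1, -z 2, 0;
      0, 0, 0, z 3, z 4;
      0, 0, 0, 0, z 5;
      0, 0, 0, 0, 0])
    (by intro x j k; fin_cases j <;> fin_cases k <;> simp [netL1L2, Fin.sum_univ_three])
    (by intro z w; ext k l; fin_cases k <;> fin_cases l <;> simp <;> ring)
    (by intro r z; ext k l; fin_cases k <;> fin_cases l <;> simp)
    (by
      intro z h
      ext i; fin_cases i
      exacts [by simpa using h 0 1, by simpa using h 0 3, by simpa using h 0 4,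
        by simpa using h 2 3, by simpa using h 2 4, by simpa using h 3 4])
    (by intro x k l; fin_cases k <;> fin_cases l <;> simp [netL1L2, veroneseMap] <;> ring)
    zariskiClosure_veroneseSurface
    (fun x h => (mk_mem_veroneseSurface h).2 ((veroneseSurface_iff _).1
      ⟨x 0, x 1, x 2, rfl⟩)) fun v hv h =>
      mem_closure_veroneseMap hv ((veroneseSurface_iff v).2 ((mk_mem_veroneseSurface hv).1 h))

theorem isLinearCopy_of_netL1L1L1 (h : HasNormalForm T netL1L1L1) :
    IsLinearCopy (collineationVariety 2 T) veroneseSurface := by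
  refine h.isLinearCopy (q := veroneseMap) (P := fun z => !![
      0, z 0, 0, z 1, 0, z 2;
      0, 0, -z 1, 0, -z 2, 0;
      0, 0, 0, z 3, 0, z 4;
      0, 0, 0, 0, -z 4, 0;
      0, 0, 0, 0, 0, z 5;
      0, 0, 0, 0, 0, 0])
    (by intro x j k; fin_cases j <;> fin_cases k <;> simp [netL1L1L1, Fin.sum_univ_three])
    (by intro z w; ext k l; fin_cases k <;> fin_cases l <;> simp <;> ring)
    (by intro r z; ext k l; fin_cases k <;> fin_cases l <;> simp)
    (by
      intro z h
      ext i; fin_cases i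
      exacts [by simpa using h 0 1, by simpa using h 0 3, by simpa using h 0 5,
        by simpa using h 2 3, by simpa using h 2 5, by simpa using h 4 5])
    (by intro x k l; fin_cases k <;> fin_cases l <;> simp [netL1L1L1, veroneseMap] <;> ring)
    zariskiClosure_veroneseSurface
    (fun x h => (mk_mem_veroneseSurface h).2 ((veroneseSurface_iff _).1
      ⟨x 0, x 1, x 2, rfl⟩)) fun v hv h =>
      mem_closure_veroneseMap hv ((veroneseSurface_iff v).2 ((mk_mem_veroneseSurface hv).1 h))

end NormalFormVarieties

/-! ### From tensors to subspaces of `V₁ ⊗ ℂ²` -/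

section Slices

variable {V₁ V₂ V₃ : Type*} [AddCommGroup V₁] [Module ℂ V₁] [AddCommGroup V₂] [Module ℂ V₂]
  [AddCommGroup V₃] [Module ℂ V₃]

/-- The map `V₃* → V₁ × V₁` given by the third flattening and a basis of `V₂`. -/
def sliceMap (T : V₁ ⊗[ℂ] (V₂ ⊗[ℂ] V₃)) (b : Module.Basis (Fin 2) ℂ V₂) :
    Module.Dual ℂ V₃ →ₗ[ℂ] V₁ × V₁ where
  toFun φ := (contractSnd (b.coord 0) (flattening₃ T φ), contractSnd (b.coord 1) (flattening₃ T φ))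
  map_add' φ ψ := by
    have : flattening₃ T (φ + ψ) = flattening₃ T φ + flattening₃ T ψ := by
      simp [flattening₃, contractSnd, LinearMap.lTensor_add, LinearMap.comp_add]
    simp [this]
  map_smul' r φ := by
    have : flattening₃ T (r • φ) = r • flattening₃ T φ := by
      simp [flattening₃, contractSnd, LinearMap.lTensor_smul, LinearMap.comp_smul]
    simp [this]

theorem eq_contractSnd_tmul_add (b : Module.Basis (Fin 2) ℂ V₂) (t : V₁ ⊗[ℂ] V₂) :
    t = contractSnd (b.coord 0) t ⊗ₜ[ℂ] b 0 + contractSnd (b.coord 1) t ⊗ₜ[ℂ] b 1 := by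
  induction t with
  | zero => simp
  | add x y hx hy =>
    conv_lhs => rw [hx, hy]
    simp only [map_add, TensorProduct.add_tmul]
    abel
  | tmul v w =>
    have hw := b.sum_repr w
    rw [Fin.sum_univ_two] at hw
    simp only [contractSnd_tmul, TensorProduct.smul_tmul, ← TensorProduct.tmul_add,
      Module.Basis.coord_apply, hw]

theorem eq_sum_tmul_contractFst {ι : Type*} [Fintype ι] (b : Module.Basis ι ℂ V₁)
    (t : V₁ ⊗[ℂ] V₂) : t = ∑ i, b i ⊗ₜ[ℂ] contractFst (b.coord i) t := by
  induction t with
  | zero => simp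
  | add x y hx hy =>
    conv_lhs => rw [hx, hy]
    simp only [map_add, TensorProduct.tmul_add, Finset.sum_add_distrib]
  | tmul v w =>
    conv_lhs => rw [← b.sum_repr v]
    simp only [contractFst_tmul, TensorProduct.tmul_smul, TensorProduct.smul_tmul',
      TensorProduct.sum_tmul, Module.Basis.coord_apply]

theorem eq_sum_contractSnd_tmul {ι : Type*} [Fintype ι] (b : Module.Basis ι ℂ V₂)
    (t : V₁ ⊗[ℂ] V₂) : t = ∑ i, contractSnd (b.coord i) t ⊗ₜ[ℂ] b i := by
  induction t with
  | zero => simp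
  | add x y hx hy =>
    conv_lhs => rw [hx, hy]
    simp only [map_add, TensorProduct.add_tmul, Finset.sum_add_distrib]
  | tmul v w =>
    conv_lhs => rw [← b.sum_repr w]
    simp only [contractSnd_tmul, TensorProduct.smul_tmul, TensorProduct.tmul_sum,
      Module.Basis.coord_apply]

/-- Contractions along different factors commute. This lets conditions on the first flattening be
read on the image of the third. -/
theorem apply_contractSnd_flattening₃ (T : V₁ ⊗[ℂ] (V₂ ⊗[ℂ] V₃)) (ξ : Module.Dual ℂ V₁)
    (ψ : Module.Dual ℂ V₂) (φ : Module.Dual ℂ V₃) :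
    ξ (contractSnd ψ (flattening₃ T φ)) = φ (contractFst ψ (flattening₁ T ξ)) := by
  unfold flattening₃ flattening₁
  induction T with
  | zero => simp
  | add x y hx hy => simp only [map_add, hx, hy]
  | tmul v t =>
    induction t with
    | zero => simp
    | add x y hx hy => simp only [TensorProduct.tmul_add, map_add, hx, hy]
    | tmul w u => simp [contractSnd_tmul, contractFst_tmul]; ring

theorem contractSnd_flattening₂ (T : V₁ ⊗[ℂ] (V₂ ⊗[ℂ] V₃)) (ψ : Module.Dual ℂ V₂)
    (φ : Module.Dual ℂ V₃) :
    contractSnd φ (flattening₂ T ψ) = contractSnd ψ (flattening₃ T φ) := by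
  unfold flattening₃ flattening₂
  induction T with
  | zero => simp
  | add x y hx hy => simp only [map_add, hx, hy]
  | tmul v t =>
    induction t with
    | zero => simp
    | add x y hx hy => simp only [TensorProduct.tmul_add, map_add, hx, hy]
    | tmul w u => simp [contractSnd_tmul, contractFst_tmul, smul_smul, mul_comm]

theorem eq_sum_sliceMap {ι : Type*} [Fintype ι] (T : V₁ ⊗[ℂ] (V₂ ⊗[ℂ] V₃))
    (b : Module.Basis (Fin 2) ℂ V₂) (c : Module.Basis ι ℂ V₃) :
    T = ∑ k, ((sliceMap T b (c.coord k)).1 ⊗ₜ[ℂ] (b 0 ⊗ₜ[ℂ] c k) +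
      (sliceMap T b (c.coord k)).2 ⊗ₜ[ℂ] (b 1 ⊗ₜ[ℂ] c k)) := by
  change T = ∑ k, (contractSnd (b.coord 0) ((contractSnd (c.coord k)).lTensor V₁ T) ⊗ₜ[ℂ]
      (b 0 ⊗ₜ[ℂ] c k) + contractSnd (b.coord 1) ((contractSnd (c.coord k)).lTensor V₁ T) ⊗ₜ[ℂ]
      (b 1 ⊗ₜ[ℂ] c k))
  induction T with
  | zero => simp
  | add x y hx hy =>
    conv_lhs => rw [hx, hy]
    simp only [map_add, TensorProduct.add_tmul, ← Finset.sum_add_distrib]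
    exact Finset.sum_congr rfl fun _ _ => by abel
  | tmul v t =>
    conv_lhs => rw [eq_sum_contractSnd_tmul c t, TensorProduct.tmul_sum]
    refine Finset.sum_congr rfl fun k _ => ?_
    have hw := b.sum_repr (contractSnd (c.coord k) t)
    rw [Fin.sum_univ_two] at hw
    conv_lhs => rw [← hw]
    simp only [LinearMap.lTensor_tmul, contractSnd_tmul, TensorProduct.add_tmul,
      TensorProduct.tmul_add, TensorProduct.smul_tmul, TensorProduct.tmul_smul,
      Module.Basis.coord_apply]

/-- A subspace of `V × V = V ⊗ ℂ²` is concise if it lies neither in `V' ⊗ ℂ²` nor in `V ⊗ L` for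
proper subspaces `V'` and `L`. -/
structure IsConciseSubspace {V : Type*} [AddCommGroup V] [Module ℂ V]
    (U : Submodule ℂ (V × V)) : Prop where
  eq_zero_of_forall : ∀ ξ : Module.Dual ℂ V, (∀ x ∈ U, ξ x.1 = 0 ∧ ξ x.2 = 0) → ξ = 0
  coeff_eq_zero : ∀ s t : ℂ, (∀ x ∈ U, s • x.1 + t • x.2 = 0) → s = 0 ∧ t = 0

theorem sliceMap_injective {T : V₁ ⊗[ℂ] (V₂ ⊗[ℂ] V₃)} (hT : IsConcise T)
    (b : Module.Basis (Fin 2) ℂ V₂) : Function.Injective (sliceMap T b) := by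
  intro φ ψ h
  refine hT.2.2 ?_
  rw [eq_contractSnd_tmul_add b (flattening₃ T φ), eq_contractSnd_tmul_add b (flattening₃ T ψ)]
  have h1 := congrArg Prod.fst h
  have h2 := congrArg Prod.snd h
  simp only [sliceMap, LinearMap.coe_mk, AddHom.coe_mk] at h1 h2
  rw [h1, h2]

/-- The two conditions translate injectivity of the first and of the second flattening; injectivity
of the third is that of `sliceMap` itself. -/
theorem isConciseSubspace_range_sliceMap [Module.Finite ℂ V₃] {T : V₁ ⊗[ℂ] (V₂ ⊗[ℂ] V₃)}
    (hT : IsConcise T) (b : Module.Basis (Fin 2) ℂ V₂) :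
    IsConciseSubspace (LinearMap.range (sliceMap T b)) where
  eq_zero_of_forall ξ hξ := by
    refine hT.1 ?_
    have h0 : flattening₁ T 0 = 0 := by simp [flattening₁, contractFst]
    rw [h0, eq_sum_tmul_contractFst b (flattening₁ T ξ)]
    refine Finset.sum_eq_zero fun j _ => ?_
    have : contractFst (b.coord j) (flattening₁ T ξ) = 0 := by
      rw [← Module.forall_dual_apply_eq_zero_iff ℂ]
      intro φ
      rw [← apply_contractSnd_flattening₃]
      have := hξ _ ⟨φ, rfl⟩
      fin_cases j
      exacts [this.1, this.2]
    rw [this, TensorProduct.tmul_zero]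
  coeff_eq_zero s t h := by
    have h0 : flattening₂ T 0 = 0 := by simp [flattening₂, contractFst]
    have : s • b.coord 0 + t • b.coord 1 = 0 := by
      refine hT.2.1 ?_
      rw [h0, eq_sum_contractSnd_tmul (Module.finBasis ℂ V₃) (flattening₂ T _)]
      refine Finset.sum_eq_zero fun k _ => ?_
      have hk := h _ ⟨(Module.finBasis ℂ V₃).coord k, rfl⟩
      rw [contractSnd_flattening₂]
      have : ∀ x, contractSnd (V := V₁) (s • b.coord 0 + t • b.coord 1) x =
          s • contractSnd (b.coord 0) x + t • contractSnd (b.coord 1) x := by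
        intro x
        simp [contractSnd, LinearMap.lTensor_add, LinearMap.lTensor_smul]
      rw [this]
      change _ + _ = _ at hk
      simp only [sliceMap, LinearMap.coe_mk, AddHom.coe_mk] at hk
      rw [hk, TensorProduct.zero_tmul]
    exact ⟨by simpa using LinearMap.congr_fun this (b 0),
      by simpa using LinearMap.congr_fun this (b 1)⟩

end Slices

/-! ### Normal forms of subspaces and change of basis in `ℂ²` -/

section Columns

variable {V : Type*} [AddCommGroup V] [Module ℂ V]

/-- The action of a `2 × 2` matrix on `V × V = V ⊗ ℂ²`. -/
def pencilMap (V : Type*) [AddCommGroup V] [Module ℂ V] (g : Matrix (Fin 2) (Fin 2) ℂ) :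
    V × V →ₗ[ℂ] V × V where
  toFun x := (g 0 0 • x.1 + g 0 1 • x.2, g 1 0 • x.1 + g 1 1 • x.2)
  map_add' x y := by ext <;> simp <;> module
  map_smul' r x := by ext <;> simp <;> module

theorem pencilMap_apply (g : Matrix (Fin 2) (Fin 2) ℂ) (x y : V) :
    pencilMap V g (x, y) = (g 0 0 • x + g 0 1 • y, g 1 0 • x + g 1 1 • y) := rfl

theorem pencilMap_mul (g h : Matrix (Fin 2) (Fin 2) ℂ) (x : V × V) :
    pencilMap V (g * h) x = pencilMap V g (pencilMap V h x) := by
  ext <;> simp [pencilMap, Matrix.mul_apply] <;> module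

theorem pencilMap_one (x : V × V) : pencilMap V 1 x = x := by
  ext <;> simp [pencilMap]

theorem pencilMap_bijective {g : Matrix (Fin 2) (Fin 2) ℂ} (hg : g.det ≠ 0) :
    Function.Bijective (pencilMap V g) := by
  have hu : IsUnit g.det := hg.isUnit
  refine Function.bijective_iff_has_inverse.2 ⟨pencilMap V g⁻¹, fun x => ?_, fun x => ?_⟩
  · rw [← pencilMap_mul, Matrix.nonsing_inv_mul g hu, pencilMap_one]
  · rw [← pencilMap_mul, Matrix.mul_nonsing_inv g hu, pencilMap_one]

theorem finrank_comap_pencilMap {g : Matrix (Fin 2) (Fin 2) ℂ} (hg : g.det ≠ 0)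
    (U : Submodule ℂ (V × V)) :
    Module.finrank ℂ (U.comap (pencilMap V g)) = Module.finrank ℂ U := by
  have h := LinearEquiv.finrank_map_eq (LinearEquiv.ofBijective _ (pencilMap_bijective (V := V) hg))
    (U.comap (pencilMap V g))
  have e : Submodule.map (LinearEquiv.ofBijective _ (pencilMap_bijective (V := V) hg) :
      V × V →ₗ[ℂ] V × V) (U.comap (pencilMap V g)) = U :=
    Submodule.map_comap_eq_of_surjective (pencilMap_bijective hg).2 U
  rw [e] at h
  exact h.symm

theorem IsConciseSubspace.comap {U : Submodule ℂ (V × V)} (hU : IsConciseSubspace U)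
    {g : Matrix (Fin 2) (Fin 2) ℂ} (hg : g.det ≠ 0) :
    IsConciseSubspace (U.comap (pencilMap V g)) where
  eq_zero_of_forall ξ h := by
    refine hU.eq_zero_of_forall ξ fun x hx => ?_
    obtain ⟨y, rfl⟩ := (pencilMap_bijective hg).2 x
    obtain ⟨h1, h2⟩ := h y hx
    simp [pencilMap, h1, h2]
  coeff_eq_zero s t h := by
    have hu : IsUnit g.det := hg.isUnit
    -- If the row vector `(s, t)` kills `g⁻¹ U`, then `(s, t) g⁻¹` kills `U`; it is therefore zero,
    -- and multiplying by `g` gives `(s, t) = 0`.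
    have key := hU.coeff_eq_zero (s * g⁻¹ 0 0 + t * g⁻¹ 1 0) (s * g⁻¹ 0 1 + t * g⁻¹ 1 1) ?_
    · have hinv := Matrix.nonsing_inv_mul g hu
      have e00 := congrFun (congrFun hinv 0) 0
      have e01 := congrFun (congrFun hinv 0) 1
      have e10 := congrFun (congrFun hinv 1) 0
      have e11 := congrFun (congrFun hinv 1) 1
      simp [Matrix.mul_apply] at e00 e01 e10 e11
      obtain ⟨k1, k2⟩ := key
      constructor
      · linear_combination -s * e00 - t * e10 + g 0 0 * k1 + g 1 0 * k2
      · linear_combination -s * e01 - t * e11 + g 0 1 * k1 + g 1 1 * k2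
    · intro x hx
      have hmem : pencilMap V g⁻¹ x ∈ U.comap (pencilMap V g) := by
        rw [Submodule.mem_comap, ← pencilMap_mul, Matrix.mul_nonsing_inv g hu, pencilMap_one]
        exact hx
      have := h _ hmem
      simp only [pencilMap, LinearMap.coe_mk, AddHom.coe_mk] at this
      rw [← this]
      module

/-- `U ⊆ V ⊗ ℂ²` contains the columns of the matrix of linear forms `N` in suitable bases. -/
def HasColumns {m : ℕ} (U : Submodule ℂ (V × V)) (N : (Fin 3 → ℂ) → Matrix (Fin 2) (Fin m) ℂ) :
    Prop :=
  ∃ (a : Module.Basis (Fin 3) ℂ V) (g : Matrix (Fin 2) (Fin 2) ℂ), g.det ≠ 0 ∧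
    ∀ k, pencilMap V g (∑ i, N (Pi.single i 1) 0 k • a i, ∑ i, N (Pi.single i 1) 1 k • a i) ∈ U

/-- This justifies every "after a change of basis of `ℂ²`" in the classification: base changes
compose into the matrix allowed by `HasColumns`. -/
theorem HasColumns.of_comap {m : ℕ} {U : Submodule ℂ (V × V)}
    {N : (Fin 3 → ℂ) → Matrix (Fin 2) (Fin m) ℂ} {g : Matrix (Fin 2) (Fin 2) ℂ} (hg : g.det ≠ 0)
    (h : HasColumns (U.comap (pencilMap V g)) N) : HasColumns U N := by
  obtain ⟨a, g', hg', h⟩ := h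
  refine ⟨a, g * g', by rw [Matrix.det_mul]; exact mul_ne_zero hg hg', fun k => ?_⟩
  rw [pencilMap_mul]
  exact h k

/-- Mere containment of the columns in `U` suffices. They are independent and their number is `dim
V₃`, so their preimages in `V₃*` form a basis, and the basis of `V₃` dual to it puts `T` in normal
form. -/
theorem HasColumns.hasNormalForm {V₂ V₃ : Type*} [AddCommGroup V₂] [Module ℂ V₂]
    [AddCommGroup V₃] [Module ℂ V₃] [Module.Finite ℂ V₃] {T : V ⊗[ℂ] (V₂ ⊗[ℂ] V₃)} {m : ℕ}
    {N : (Fin 3 → ℂ) → Matrix (Fin 2) (Fin m) ℂ} {b : Module.Basis (Fin 2) ℂ V₂}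
    (h : HasColumns (LinearMap.range (sliceMap T b)) N)
    (hm : Module.finrank ℂ V₃ = m)
    (hN : ∀ r : Fin m → ℂ, (∀ i j, ∑ k, r k * N (Pi.single i 1) j k = 0) → r = 0) :
    HasNormalForm T N := by
  obtain ⟨a, g, hg, h⟩ := h
  choose φ hφ using h
  have hφind : LinearIndependent ℂ φ := by
    rw [Fintype.linearIndependent_iff]
    intro r hr
    have h0 : pencilMap V g (∑ k, r k • (∑ i, N (Pi.single i 1) 0 k • a i,
        ∑ i, N (Pi.single i 1) 1 k • a i)) = 0 := by
      simp only [map_sum, map_smul, ← hφ]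
      rw [← map_zero (sliceMap T b), ← hr]
      simp
    have h1 := (pencilMap_bijective (V := V) hg).1 (h0.trans (map_zero _).symm)
    have hr0 : r = 0 := by
      refine hN r fun i j => ?_
      have hj : ∀ j, ∑ k, r k • ∑ i, N (Pi.single i 1) j k • a i = 0 := by
        intro j
        fin_cases j
        · simpa [Prod.fst_sum] using congrArg Prod.fst h1
        · simpa [Prod.snd_sum] using congrArg Prod.snd h1
      have := congrArg (fun v => a.repr v i) (hj j)
      simpa [Finsupp.single_apply] using this
    intro k
    rw [hr0]; rfl
  have hcard : Fintype.card (Fin m) = Module.finrank ℂ (Module.Dual ℂ V₃) := by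
    rw [Fintype.card_fin, Subspace.dual_finrank_eq, hm]
  have : Module.Finite ℂ V₂ := Module.Finite.of_basis b
  obtain ⟨c, hc⟩ : ∃ c : Module.Basis (Fin m) ℂ V₃, ∀ k, c.coord k = φ k := by
    let e : Module.Basis (Fin m) ℂ (Module.Dual ℂ V₃) := Module.Basis.mk hφind
      (hφind.span_eq_top_of_card_eq_finrank' hcard).ge
    refine ⟨e.dualBasis.map (Module.evalEquiv ℂ V₃).symm, fun k => ?_⟩
    refine (Module.Basis.ext (e.dualBasis.map (Module.evalEquiv ℂ V₃).symm)) fun l => ?_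
    have hk : φ k = e k := by simp [e]
    rw [hk, Module.Basis.coord_apply, Module.Basis.repr_self, Module.Basis.map_apply,
      Module.apply_evalEquiv_symm_apply, Module.Basis.dualBasis_apply,
      Module.Basis.repr_self, Finsupp.single_apply, Finsupp.single_apply]
    simp only [eq_comm]
  -- Moving `g` from the slices to the basis of `V₂` transposes it: the new basis vectors are given
  -- by the columns of `g`.
  have hb'ind : LinearIndependent ℂ
      ![g 0 0 • b 0 + g 1 0 • b 1, g 0 1 • b 0 + g 1 1 • b 1] := by
    rw [LinearIndependent.pair_iff]
    intro s t hst
    have hrepr := fun i => congrArg (fun v => b.repr v i) hst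
    have e0 := hrepr 0
    have e1 := hrepr 1
    simp at e0 e1
    rw [Matrix.det_fin_two] at hg
    constructor
    · refine (mul_eq_zero.1 ?_).resolve_left hg
      linear_combination g 1 1 * e0 - g 0 1 * e1
    · refine (mul_eq_zero.1 ?_).resolve_left hg
      linear_combination g 0 0 * e1 - g 1 0 * e0
  let b' : Module.Basis (Fin 2) ℂ V₂ := Module.Basis.mk hb'ind
    (hb'ind.span_eq_top_of_card_eq_finrank' (Module.finrank_eq_card_basis b).symm).ge
  have hb'0 : b' 0 = g 0 0 • b 0 + g 1 0 • b 1 := by simp [b']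
  have hb'1 : b' 1 = g 0 1 • b 0 + g 1 1 • b 1 := by simp [b']
  refine ⟨a, b', c, ?_⟩
  conv_lhs => rw [eq_sum_sliceMap T b c]
  rw [Finset.sum_comm]
  simp_rw [Finset.sum_comm (s := Finset.univ (α := Fin 3))]
  rw [Finset.sum_comm]
  refine Finset.sum_congr rfl fun k _ => ?_
  have e : ∀ j, ∑ i, N (Pi.single i 1) j k • (a i ⊗ₜ[ℂ] (b' j ⊗ₜ[ℂ] c k)) =
      (∑ i, N (Pi.single i 1) j k • a i) ⊗ₜ[ℂ] (b' j ⊗ₜ[ℂ] c k) := by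
    intro j
    rw [TensorProduct.sum_tmul]
    exact Finset.sum_congr rfl fun i _ => by rw [TensorProduct.smul_tmul']
  simp only [Fin.sum_univ_two, e, hc, hφ, pencilMap_apply, hb'0, hb'1]
  simp only [TensorProduct.add_tmul, TensorProduct.tmul_add, ← TensorProduct.smul_tmul',
    TensorProduct.tmul_smul]
  abel

end Columns

/-! ### Linear algebra: independence, nilpotency, rank-one elements -/

section LinearAlgebra

variable {V : Type*} [AddCommGroup V] [Module ℂ V]

theorem linearIndependent_triple_iff {x y z : V} :
    LinearIndependent ℂ ![x, y, z] ↔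
      ∀ r s t : ℂ, r • x + s • y + t • z = 0 → r = 0 ∧ s = 0 ∧ t = 0 := by
  rw [Fintype.linearIndependent_iff]
  constructor
  · intro h r s t hrst
    have := h ![r, s, t] (by simpa [Fin.sum_univ_three] using hrst)
    exact ⟨this 0, this 1, this 2⟩
  · intro h g hg i
    rw [Fin.sum_univ_three] at hg
    obtain ⟨h0, h1, h2⟩ := h _ _ _ hg
    fin_cases i <;> assumption

theorem exists_eq_of_linearIndependent_triple (hV : Module.finrank ℂ V = 3) {x y z : V}
    (h : LinearIndependent ℂ ![x, y, z]) (v : V) : ∃ r s t : ℂ, v = r • x + s • y + t • z := by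
  have : Module.Finite ℂ V := Module.finite_of_finrank_pos (by omega)
  have htop := h.span_eq_top_of_card_eq_finrank' (by simp [hV])
  have hv : v ∈ Submodule.span ℂ (Set.range ![x, y, z]) := htop ▸ Submodule.mem_top
  obtain ⟨c, hc⟩ := (Submodule.mem_span_range_iff_exists_fun ℂ).1 hv
  exact ⟨c 0, c 1, c 2, by rw [← hc, Fin.sum_univ_three]; rfl⟩

theorem linearIndependent_triple_of_pair {x y z : V} (h : LinearIndependent ℂ ![x, y])
    (hz : ∀ r s : ℂ, z ≠ r • x + s • y) : LinearIndependent ℂ ![x, y, z] := by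
  rw [LinearIndependent.pair_iff] at h
  rw [linearIndependent_triple_iff]
  intro r s t hrst
  have ht : t = 0 := by
    by_contra ht
    refine hz (-(t⁻¹ * r)) (-(t⁻¹ * s)) ?_
    have : z = t⁻¹ • (t • z) := by rw [smul_smul, inv_mul_cancel₀ ht, one_smul]
    rw [this, show t • z = -(r • x + s • y) from (neg_eq_of_add_eq_zero_right hrst).symm]
    module
  subst ht
  obtain ⟨h1, h2⟩ := h r s (by simpa using hrst)
  exact ⟨h1, h2, rfl⟩

theorem exists_smul_eq_of_not_linearIndependent {x y : V} (hx : x ≠ 0)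
    (h : ¬LinearIndependent ℂ ![x, y]) : ∃ r : ℂ, y = r • x := by
  by_contra! hcon
  exact h ((LinearIndependent.pair_iff' hx).2 fun a ha => hcon a ha.symm)

theorem exists_eq_of_not_linearIndependent_triple {x y z : V} (h : LinearIndependent ℂ ![x, y])
    (h' : ¬LinearIndependent ℂ ![x, y, z]) : ∃ r s : ℂ, z = r • x + s • y := by
  by_contra! hcon
  exact h' (linearIndependent_triple_of_pair h hcon)

/-- In a space of dimension at least three there is a nonzero linear form vanishing at two given
vectors. -/
theorem exists_dual_ne_zero (hV : Module.finrank ℂ V = 3) (x y : V) :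
    ∃ ξ : Module.Dual ℂ V, ξ ≠ 0 ∧ ∀ r s : ℂ, ξ (r • x + s • y) = 0 := by
  have : Module.Finite ℂ V := Module.finite_of_finrank_pos (by omega)
  have hlt : Submodule.span ℂ (Set.range ![x, y]) < ⊤ := by
    rw [lt_top_iff_ne_top]
    intro htop
    have := finrank_range_le_card (R := ℂ) ![x, y]
    rw [Set.finrank, htop, finrank_top, hV] at this
    simp at this
  obtain ⟨ξ, hξ, hker⟩ := Submodule.exists_le_ker_of_lt_top _ hlt
  have hx : ξ x = 0 := hker (Submodule.subset_span ⟨0, rfl⟩)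
  have hy : ξ y = 0 := hker (Submodule.subset_span ⟨1, rfl⟩)
  exact ⟨ξ, hξ, fun r s => by simp [hx, hy]⟩

theorem exists_notMem_of_finrank_lt {n : ℕ} {W : Type*} [AddCommGroup W] [Module ℂ W]
    (U : Submodule ℂ W) (v : Fin n → W) (h : n < Module.finrank ℂ U) :
    ∃ x ∈ U, x ∉ Submodule.span ℂ (Set.range v) := by
  by_contra! hcon
  have hle : U ≤ Submodule.span ℂ (Set.range v) := hcon
  have : Module.Finite ℂ (Submodule.span ℂ (Set.range v)) :=
    Module.Finite.span_of_finite ℂ (Set.finite_range v)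
  have h1 := Submodule.finrank_mono hle
  have h2 := finrank_range_le_card (R := ℂ) v
  rw [Fintype.card_fin] at h2
  rw [Set.finrank] at h2
  omega

theorem exists_ne_zero_of_finrank_lt {W W' : Type*} [AddCommGroup W] [Module ℂ W]
    [AddCommGroup W'] [Module ℂ W'] [Module.Finite ℂ W'] (U : Submodule ℂ W) (f : W →ₗ[ℂ] W')
    (h : Module.finrank ℂ W' < Module.finrank ℂ U) : ∃ x ∈ U, x ≠ 0 ∧ f x = 0 := by
  have : Module.Finite ℂ U := Module.finite_of_finrank_pos (by omega)
  have hne := LinearMap.ker_ne_bot_of_finrank_lt (f := f ∘ₗ U.subtype) h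
  obtain ⟨x, hx, hx0⟩ := Submodule.exists_mem_ne_zero_of_ne_bot hne
  exact ⟨x, x.2, by simpa using hx0, by simpa using hx⟩

/-- An endomorphism of a complex vector space without nonzero eigenvalues is nilpotent. -/
theorem pow_finrank_eq_zero_of_eigenvalues [Module.Finite ℂ V] (M : Module.End ℂ V)
    (h : ∀ (μ : ℂ) x, M x = μ • x → x ≠ 0 → μ = 0) : M ^ Module.finrank ℂ V = 0 := by
  have hroots : ∀ μ ∈ M.charpoly.roots, μ = 0 := by
    intro μ hμ
    have : M.HasEigenvalue μ := by
      rw [Module.End.hasEigenvalue_iff_isRoot_charpoly]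
      exact (Polynomial.mem_roots'.1 hμ).2
    obtain ⟨x, hx⟩ := this.exists_hasEigenvector
    exact h μ x hx.apply_eq_smul hx.2
  -- All roots of the characteristic polynomial are zero, so it is a power of `X`; conclude by
  -- Cayley–Hamilton.
  have hs := (IsAlgClosed.splits M.charpoly)
  have hp := hs.eq_prod_roots_of_monic M.charpoly_monic
  rw [Multiset.eq_replicate_card.2 hroots, Multiset.map_replicate, Multiset.prod_replicate] at hp
  have hdeg := congrArg Polynomial.natDegree hp
  rw [LinearMap.charpoly_natDegree] at hdeg
  simp at hdeg
  have := M.aeval_self_charpoly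
  rw [hp, ← hdeg] at this
  simpa using this

/-- A subspace of `W ⊗ ℂ²` of dimension at least `dim W` contains an element of rank one. -/
theorem exists_rank_one {W : Type*} [AddCommGroup W] [Module ℂ W] [Module.Finite ℂ W]
    [Nontrivial W] (U : Submodule ℂ (W × W)) (h : Module.finrank ℂ W ≤ Module.finrank ℂ U) :
    ∃ w : W, w ≠ 0 ∧ ∃ s t : ℂ, (s ≠ 0 ∨ t ≠ 0) ∧ (s • w, t • w) ∈ U := by
  let π : U →ₗ[ℂ] W := LinearMap.fst ℂ W W ∘ₗ U.subtype
  -- If the first projection is injective on `U`, then `U` is the graph of an endomorphism and an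
  -- eigenvector gives a rank-one element; otherwise some nonzero `(0, w)` lies in `U`.
  by_cases hinj : Function.Injective π
  · have hfin : Module.finrank ℂ U = Module.finrank ℂ W :=
      le_antisymm (LinearMap.finrank_le_finrank_of_injective hinj) h
    let e := LinearEquiv.ofInjectiveOfFinrankEq π hinj hfin
    let M : Module.End ℂ W := LinearMap.snd ℂ W W ∘ₗ U.subtype ∘ₗ e.symm.toLinearMap
    obtain ⟨μ, hμ⟩ := Module.End.exists_eigenvalue M
    obtain ⟨w, hw⟩ := hμ.exists_hasEigenvector
    refine ⟨w, hw.2, 1, μ, Or.inl one_ne_zero, ?_⟩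
    have h1 : (e.symm w : W × W).1 = w := e.apply_symm_apply w
    have h2 : (e.symm w : W × W).2 = μ • w := hw.apply_eq_smul
    have : ((1 : ℂ) • w, μ • w) = (e.symm w : W × W) := by
      rw [one_smul]
      exact Prod.ext h1.symm h2.symm
    rw [this]
    exact (e.symm w).2
  · rw [injective_iff_map_eq_zero] at hinj
    push Not at hinj
    obtain ⟨x, hx, hx0⟩ := hinj
    have hx1 : (x : W × W).1 = 0 := hx
    refine ⟨(x : W × W).2, fun h2 => hx0 (Subtype.ext (Prod.ext hx1 h2)), 0, 1,
      Or.inr one_ne_zero, ?_⟩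
    rw [zero_smul, one_smul, ← hx1]
    exact x.2

variable {U : Submodule ℂ (V × V)}

/-- The length is fixed at three; shorter combinations repeat a member with coefficient zero. -/
theorem mem_of_eq_comb {x₁ y₁ x₂ y₂ x₃ y₃ u v : V} (h₁ : (x₁, y₁) ∈ U) (h₂ : (x₂, y₂) ∈ U)
    (h₃ : (x₃, y₃) ∈ U) (r s t : ℂ) (hu : u = r • x₁ + s • x₂ + t • x₃)
    (hv : v = r • y₁ + s • y₂ + t • y₃) : (u, v) ∈ U := by
  have : (u, v) = r • (x₁, y₁) + s • (x₂, y₂) + t • (x₃, y₃) := Prod.ext hu hv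
  rw [this]
  exact U.add_mem (U.add_mem (U.smul_mem r h₁) (U.smul_mem s h₂)) (U.smul_mem t h₃)

theorem HasColumns.of_linearIndependent {m : ℕ} {N : (Fin 3 → ℂ) → Matrix (Fin 2) (Fin m) ℂ}
    (hV : Module.finrank ℂ V = 3) {x : Fin 3 → V} (hx : LinearIndependent ℂ x)
    (g : Matrix (Fin 2) (Fin 2) ℂ) (hg : g.det ≠ 0)
    (h : ∀ k, pencilMap V g
      (∑ i, N (Pi.single i 1) 0 k • x i, ∑ i, N (Pi.single i 1) 1 k • x i) ∈ U) :
    HasColumns U N := by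
  have : Module.Finite ℂ V := Module.finite_of_finrank_pos (by omega)
  let a : Module.Basis (Fin 3) ℂ V := Module.Basis.mk hx
    (hx.span_eq_top_of_card_eq_finrank' (by simp [hV])).ge
  refine ⟨a, g, hg, fun k => ?_⟩
  convert h k using 8 <;> simp [a]

/-- Such a `g` sends `(w, 0)` to `(s • w, t • w)`, so after pulling back along it a given rank-one
element has direction `(1, 0)`. -/
theorem exists_det_ne_zero {s t : ℂ} (h : s ≠ 0 ∨ t ≠ 0) :
    ∃ g : Matrix (Fin 2) (Fin 2) ℂ, g.det ≠ 0 ∧ g 0 0 = s ∧ g 1 0 = t := by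
  by_cases hs : s = 0
  · exact ⟨!![s, 1; t, 0], by simpa [Matrix.det_fin_two] using h.resolve_left (not_not.2 hs),
      rfl, rfl⟩
  · exact ⟨!![s, 0; t, 1], by simpa [Matrix.det_fin_two] using hs, rfl, rfl⟩

end LinearAlgebra

/-! ### Subspaces of dimension three -/

section ThreeDimensional

variable {V : Type*} [AddCommGroup V] [Module ℂ V] {U : Submodule ℂ (V × V)}

/-- Write `v = r p + s q + t u`. Subtracting a multiple of `(0, q)` removes `s`. If `t = 0`, the
third element becomes `(u, r p)`, of rank one or a Jordan block with `(p, 0)` according to whether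
`r` vanishes. If `t ≠ 0`, it can be completed to a rank-one element of a third direction. -/
theorem hasColumns_of_two_rank_one_aux (hV : Module.finrank ℂ V = 3) {p q u v : V}
    (hp : (p, 0) ∈ U) (hq : (0, q) ∈ U) (huv : (u, v) ∈ U) (h : LinearIndependent ℂ ![p, q, u]) :
    HasColumns U netJ1J1J1' ∨ HasColumns U netJ2J1' ∨ HasColumns U netJ1J1'J1'' := by
  obtain ⟨r, s, t, hv⟩ := exists_eq_of_linearIndependent_triple hV h v
  have h0 := linearIndependent_triple_iff.1 h
  by_cases ht : t = 0
  · by_cases hr : r = 0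
    · refine Or.inl (HasColumns.of_linearIndependent hV (x := ![p, u, q]) ?_ 1 (by simp)
        fun k => ?_)
      · rw [linearIndependent_triple_iff]
        intro a b c habc
        obtain ⟨h1, h2, h3⟩ := h0 a c b (by rw [← habc]; module)
        exact ⟨h1, h3, h2⟩
      · rw [pencilMap_one]
        fin_cases k <;> simp [netJ1J1J1', Fin.sum_univ_three]
        · exact hp
        · exact mem_of_eq_comb huv hq hq 1 (-s) 0 (by module) (by rw [hv, hr, ht]; module)
        · exact hq
    · refine Or.inr (Or.inl (HasColumns.of_linearIndependent hV (x := ![r • p, u, q]) ?_ 1 (by simp)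
        fun k => ?_))
      · rw [linearIndependent_triple_iff]
        intro a b c habc
        obtain ⟨h1, h2, h3⟩ := h0 (a * r) c b (by rw [← habc]; module)
        exact ⟨(mul_eq_zero.1 h1).resolve_right hr, h3, h2⟩
      · rw [pencilMap_one]
        fin_cases k <;> simp [netJ2J1', Fin.sum_univ_three]
        · exact mem_of_eq_comb hp hp hp r 0 0 (by module) (by module)
        · exact mem_of_eq_comb huv hq hq 1 (-s) 0 (by module) (by rw [hv, ht]; module)
        · exact hq
  -- Adding `(r / t) (p, 0)` makes the element `u' ⊗ (1, t)` with `u' = u + (r / t) p`, and the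
  -- diagonal matrix rescales its direction to `(1, 1)`.
  · refine Or.inr (Or.inr (HasColumns.of_linearIndependent hV (x := ![p, q, u + (r / t) • p]) ?_
      !![1, 0; 0, t] (by simpa using ht) fun k => ?_))
    · rw [linearIndependent_triple_iff]
      intro a b c habc
      obtain ⟨h1, h2, h3⟩ := h0 (a + c * (r / t)) b c (by rw [← habc]; module)
      rw [h3, zero_mul, add_zero] at h1
      exact ⟨h1, h2, h3⟩
    · rw [pencilMap_apply]
      fin_cases k <;> simp [netJ1J1'J1'', Fin.sum_univ_three]
      · exact hp
      · exact mem_of_eq_comb hq hq hq t 0 0 (by module) (by module)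
      · refine mem_of_eq_comb huv hp hq 1 (r / t) (-s) (by module) ?_
        rw [hv]
        match_scalars <;> field_simp
        ring

/-- If `p` and `q` are independent, conciseness gives an element of `U` with a component outside
their span; exchanging the coordinates of `ℂ²` if necessary, this is the first component. If they
are proportional, `U` contains `p ⊗ ℂ²`, and conciseness forces `p` and the components of a further
element to be a basis. -/
theorem hasColumns_of_two_rank_one (hV : Module.finrank ℂ V = 3) (hU : IsConciseSubspace U)
    (hdim : Module.finrank ℂ U = 3) {p q : V} (hp0 : p ≠ 0) (hq0 : q ≠ 0)
    (hp : (p, 0) ∈ U) (hq : (0, q) ∈ U) :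
    HasColumns U netL1R1 ∨ HasColumns U netJ1J1J1' ∨ HasColumns U netJ2J1' ∨
      HasColumns U netJ1J1'J1'' := by
  by_cases hpq : LinearIndependent ℂ ![p, q]
  · refine Or.inr ?_
    obtain ⟨ξ, hξ0, hξ⟩ := exists_dual_ne_zero hV p q
    have hex : ∃ x ∈ U, ξ x.1 ≠ 0 ∨ ξ x.2 ≠ 0 := by
      by_contra! hcon
      exact hξ0 (hU.eq_zero_of_forall ξ hcon)
    obtain ⟨⟨u, v⟩, huv, h | h⟩ := hex
    · refine hasColumns_of_two_rank_one_aux hV hp hq huv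
        (linearIndependent_triple_of_pair hpq ?_)
      rintro a b rfl
      exact h (hξ a b)
    · have hdet : (!![0, 1; 1, 0] : Matrix (Fin 2) (Fin 2) ℂ).det ≠ 0 := by simp
      have key := hasColumns_of_two_rank_one_aux
        (U := U.comap (pencilMap V !![0, 1; 1, 0])) hV (p := q) (q := p) (u := v) (v := u)
        (by simpa [pencilMap_apply] using hq) (by simpa [pencilMap_apply] using hp)
        (by simpa [pencilMap_apply] using huv)
        (linearIndependent_triple_of_pair (LinearIndependent.pair_symm_iff.1 hpq) ?_)
      · exact key.imp (fun h => h.of_comap hdet) (Or.imp (fun h => h.of_comap hdet)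
          (fun h => h.of_comap hdet))
      · rintro a b rfl
        exact h (by rw [add_comm]; exact hξ b a)
  · obtain ⟨r, rfl⟩ := exists_smul_eq_of_not_linearIndependent hp0 hpq
    have hr : r ≠ 0 := by rintro rfl; simp at hq0
    have hq' : (0, p) ∈ U := mem_of_eq_comb hq hq hq r⁻¹ 0 0 (by module)
      (by rw [smul_smul, inv_mul_cancel₀ hr]; module)
    obtain ⟨⟨u, v⟩, huv, hnot⟩ := exists_notMem_of_finrank_lt U ![(p, 0), (0, p)] (by omega)
    refine Or.inl (HasColumns.of_linearIndependent hV (x := ![p, u, v]) ?_ 1 (by simp) fun k => ?_)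
    · have hind : LinearIndependent ℂ ![((p, 0) : V × V), (0, p), (u, v)] := by
        refine linearIndependent_triple_of_pair ?_ ?_
        · rw [LinearIndependent.pair_iff]
          intro a b hab
          simpa [hp0] using hab
        · intro a b hab
          rw [hab] at hnot
          exact hnot (Submodule.add_mem _ (Submodule.smul_mem _ _ (Submodule.subset_span ⟨0, rfl⟩))
            (Submodule.smul_mem _ _ (Submodule.subset_span ⟨1, rfl⟩)))
      have hspan : Submodule.span ℂ (Set.range ![((p, 0) : V × V), (0, p), (u, v)]) = U := by
        have : Module.Finite ℂ U := Module.finite_of_finrank_pos (by omega)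
        refine Submodule.eq_of_le_of_finrank_eq ?_ ?_
        · rw [Submodule.span_le]
          rintro _ ⟨i, rfl⟩
          fin_cases i
          exacts [hp, hq', huv]
        · rw [finrank_span_eq_card hind, hdim]
          simp
      have : Module.Finite ℂ V := Module.finite_of_finrank_pos (by omega)
      refine linearIndependent_of_top_le_span_of_card_eq_finrank ?_ (by simp [hV])
      by_contra hcon
      obtain ⟨ξ, hξ0, hξ⟩ := Submodule.exists_le_ker_of_lt_top _ (lt_top_iff_ne_top.2
        fun h => hcon h.ge)
      refine hξ0 (hU.eq_zero_of_forall ξ fun x hx => ?_)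
      have hξp : ξ p = 0 := hξ (Submodule.subset_span ⟨0, rfl⟩)
      have hξu : ξ u = 0 := hξ (Submodule.subset_span ⟨1, rfl⟩)
      have hξv : ξ v = 0 := hξ (Submodule.subset_span ⟨2, rfl⟩)
      rw [← hspan] at hx
      obtain ⟨c, rfl⟩ := (Submodule.mem_span_range_iff_exists_fun ℂ).1 hx
      simp [Fin.sum_univ_three, hξp, hξu, hξv]
    · rw [pencilMap_one]
      fin_cases k <;> simp [netL1R1, Fin.sum_univ_three]
      exacts [hp, hq', huv]

/-- The graph of a nonzero nilpotent endomorphism of a three-dimensional space. -/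
theorem hasColumns_of_nilpotent (hV : Module.finrank ℂ V = 3) (M : Module.End ℂ V)
    (hM : M ^ 3 = 0) (hM0 : M ≠ 0) (hU : ∀ x, (x, M x) ∈ U) :
    HasColumns U netJ2J1 ∨ HasColumns U netJ3 := by
  have : Module.Finite ℂ V := Module.finite_of_finrank_pos (by omega)
  have hM3 : ∀ x, M (M (M x)) = 0 := fun x => by
    have := LinearMap.congr_fun hM x
    simpa [pow_succ] using this
  by_cases h2 : ∃ v, M (M v) ≠ 0
  · obtain ⟨v, hv⟩ := h2
    refine Or.inr (HasColumns.of_linearIndependent hV (x := ![M (M v), M v, v]) ?_ 1 (by simp)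
      fun k => ?_)
    · rw [linearIndependent_triple_iff]
      intro a b c habc
      have e2 := congrArg (fun x => M (M x)) habc
      simp [hM3] at e2
      have hc : c = 0 := e2.resolve_right hv
      subst hc
      have e1 := congrArg M habc
      simp [hM3] at e1
      have hb : b = 0 := e1.resolve_right hv
      subst hb
      simp at habc
      exact ⟨habc.resolve_right hv, rfl, rfl⟩
    · rw [pencilMap_one]
      fin_cases k <;> simp [netJ3, Fin.sum_univ_three]
      · simpa [hM3] using hU (M (M v))
      · exact hU (M v)
      · exact hU v
  -- Now `M² = 0`, so the range lies in the kernel, which has dimension at least two and contains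
  -- some `w` off the line of `M v`: Jordan type `(2, 1)`.
  · push Not at h2
    obtain ⟨v, hv⟩ : ∃ v, M v ≠ 0 := by
      by_contra! hcon
      exact hM0 (LinearMap.ext hcon)
    have hrank := LinearMap.finrank_range_add_finrank_ker M
    have hle : LinearMap.range M ≤ LinearMap.ker M := by
      rintro _ ⟨x, rfl⟩
      exact h2 x
    have hle' := Submodule.finrank_mono hle
    obtain ⟨w, hw, hwn⟩ := exists_notMem_of_finrank_lt (LinearMap.ker M) ![M v] (by omega)
    rw [LinearMap.mem_ker] at hw
    have hwn' : LinearIndependent ℂ ![M v, w] := by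
      rw [LinearIndependent.pair_iff' hv]
      intro a ha
      exact hwn (ha ▸ Submodule.smul_mem _ _ (Submodule.subset_span ⟨0, rfl⟩))
    refine Or.inl (HasColumns.of_linearIndependent hV (x := ![M v, v, w]) ?_ 1 (by simp)
      fun k => ?_)
    · rw [linearIndependent_triple_iff]
      intro a b c habc
      have e1 := congrArg M habc
      simp [h2, hw] at e1
      have hb : b = 0 := e1.resolve_right hv
      subst hb
      obtain ⟨ha, hc⟩ := LinearIndependent.pair_iff.1 hwn' a c (by simpa using habc)
      exact ⟨ha, rfl, hc⟩
    · rw [pencilMap_one]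
      fin_cases k <;> simp [netJ2J1, Fin.sum_univ_three]
      · simpa [h2] using hU (M v)
      · exact hU v
      · simpa [hw] using hU w

/-- Move a rank-one element to the direction `(1, 0)`. If another direction occurs, a shear makes it
`(0, 1)`. If none does, `U` is the graph of an endomorphism without nonzero eigenvalues, hence
nilpotent; it is nonzero since `U` does not lie in `V ⊗ (1, 0)`. -/
theorem hasColumns_of_finrank_eq_three (hV : Module.finrank ℂ V = 3) (hU : IsConciseSubspace U)
    (hdim : Module.finrank ℂ U = 3) :
    HasColumns U netJ2J1 ∨ HasColumns U netJ1J1J1' ∨ HasColumns U netL1R1 ∨ HasColumns U netJ3 ∨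
      HasColumns U netJ2J1' ∨ HasColumns U netJ1J1'J1'' := by
  have : Module.Finite ℂ V := Module.finite_of_finrank_pos (by omega)
  have : Nontrivial V := Module.nontrivial_of_finrank_pos (R := ℂ) (by omega)
  obtain ⟨p, hp0, s, t, hst, hp⟩ := exists_rank_one U (by omega)
  obtain ⟨g, hg, rfl, rfl⟩ := exists_det_ne_zero hst
  suffices key : ∀ U' : Submodule ℂ (V × V), IsConciseSubspace U' → Module.finrank ℂ U' = 3 →
      (p, 0) ∈ U' → HasColumns U' netJ2J1 ∨ HasColumns U' netJ1J1J1' ∨ HasColumns U' netL1R1 ∨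
      HasColumns U' netJ3 ∨ HasColumns U' netJ2J1' ∨ HasColumns U' netJ1J1'J1'' by
    have := key (U.comap (pencilMap V g)) (hU.comap hg) (by rw [finrank_comap_pencilMap hg, hdim])
      (by simpa [pencilMap_apply] using hp)
    exact this.imp (·.of_comap hg) (Or.imp (·.of_comap hg) (Or.imp (·.of_comap hg)
      (Or.imp (·.of_comap hg) (Or.imp (·.of_comap hg) (·.of_comap hg)))))
  intro U hU hdim hp
  by_cases hex : ∃ (q : V) (c : ℂ), q ≠ 0 ∧ (c • q, q) ∈ U
  · obtain ⟨q, c, hq0, hq⟩ := hex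
    have hdet : (!![1, c; 0, 1] : Matrix (Fin 2) (Fin 2) ℂ).det ≠ 0 := by simp
    have := hasColumns_of_two_rank_one hV (hU.comap hdet)
      (by rw [finrank_comap_pencilMap hdet, hdim]) hp0 hq0
      (by simpa [pencilMap_apply] using hp) (by simpa [pencilMap_apply] using hq)
    rcases this with h | h | h | h
    exacts [Or.inr (Or.inr (Or.inl (h.of_comap hdet))), Or.inr (Or.inl (h.of_comap hdet)),
      Or.inr (Or.inr (Or.inr (Or.inr (Or.inl (h.of_comap hdet))))),
      Or.inr (Or.inr (Or.inr (Or.inr (Or.inr (h.of_comap hdet)))))]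
  · push Not at hex
    let π : U →ₗ[ℂ] V := LinearMap.fst ℂ V V ∘ₗ U.subtype
    have hinj : Function.Injective π := by
      rw [injective_iff_map_eq_zero]
      intro x hx
      have hx1 : (x : V × V).1 = 0 := hx
      by_contra hx0
      refine hex (x : V × V).2 0 (fun h2 => hx0 (Subtype.ext (Prod.ext hx1 h2))) ?_
      rw [zero_smul, ← hx1]
      exact x.2
    let e := LinearEquiv.ofInjectiveOfFinrankEq π hinj (by rw [hdim, hV])
    let M : Module.End ℂ V := LinearMap.snd ℂ V V ∘ₗ U.subtype ∘ₗ e.symm.toLinearMap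
    have hM : ∀ x, (x, M x) ∈ U := by
      intro x
      have h1 : (e.symm x : V × V).1 = x := e.apply_symm_apply x
      have : (x, M x) = (e.symm x : V × V) := Prod.ext h1.symm rfl
      rw [this]
      exact (e.symm x).2
    have hM' : ∀ x ∈ U, x.2 = M x.1 := by
      intro x hx
      have : e.symm x.1 = ⟨x, hx⟩ := by
        rw [LinearEquiv.symm_apply_eq]; rfl
      change x.2 = (e.symm x.1 : V × V).2
      rw [this]
    have hnil := pow_finrank_eq_zero_of_eigenvalues M ?_
    · rw [hV] at hnil
      have hM0 : M ≠ 0 := by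
        intro h0
        have := hU.coeff_eq_zero 0 1 fun x hx => by rw [hM' x hx, h0]; simp
        simpa using this.2
      rcases hasColumns_of_nilpotent (U := U) hV M hnil hM0 hM with h | h
      · exact Or.inl h
      · exact Or.inr (Or.inr (Or.inr (Or.inl h)))
    · intro μ x hx hx0
      by_contra hμ
      refine hex (μ • x) μ⁻¹ (smul_ne_zero hμ hx0) ?_
      rw [inv_smul_smul₀ hμ, ← hx]
      exact hM x

end ThreeDimensional

/-! ### Subspaces of dimension four -/

section FourDimensional

variable {V : Type*} [AddCommGroup V] [Module ℂ V] {U : Submodule ℂ (V × V)}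

/-- Modulo `x`, the image of `U` in `(V / x) ⊗ ℂ²` has dimension at least `dim V / x = 2`, so it
contains a rank-one element. Any lift of it is correct up to an element of `x ⊗ ℂ²`, which lies in
`U`. -/
theorem exists_rank_one_of_tmul_le (hV : Module.finrank ℂ V = 3)
    (hdim : Module.finrank ℂ U = 4) {x : V} (hx0 : x ≠ 0) (hx : (x, 0) ∈ U) (hx' : (0, x) ∈ U) :
    ∃ w, LinearIndependent ℂ ![x, w] ∧ ∃ s t : ℂ, (s ≠ 0 ∨ t ≠ 0) ∧ (s • w, t • w) ∈ U := by
  have : Module.Finite ℂ V := Module.finite_of_finrank_pos (by omega)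
  let K : Submodule ℂ V := ℂ ∙ x
  have hQ : Module.finrank ℂ (V ⧸ K) = 2 := by
    have := K.finrank_quotient_add_finrank
    rw [finrank_span_singleton hx0, hV] at this
    omega
  have : Nontrivial (V ⧸ K) := Module.nontrivial_of_finrank_pos (R := ℂ) (by omega)
  let f : V × V →ₗ[ℂ] (V ⧸ K) × (V ⧸ K) := K.mkQ.prodMap K.mkQ
  have hrank : 2 ≤ Module.finrank ℂ (U.map f) := by
    have h1 := LinearMap.finrank_range_add_finrank_ker (f ∘ₗ U.subtype)
    rw [LinearMap.range_comp, Submodule.range_subtype, hdim] at h1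
    have h2 : (LinearMap.ker (f ∘ₗ U.subtype)).map U.subtype ≤
        Submodule.span ℂ (Set.range ![(x, 0), (0, x)]) := by
      rintro _ ⟨⟨⟨u, v⟩, huv⟩, hk, rfl⟩
      have hk' : f (u, v) = 0 := hk
      have hu : K.mkQ u = 0 := congrArg Prod.fst hk'
      have hv : K.mkQ v = 0 := congrArg Prod.snd hk'
      rw [Submodule.mkQ_apply, Submodule.Quotient.mk_eq_zero] at hu hv
      obtain ⟨a, rfl⟩ := Submodule.mem_span_singleton.1 hu
      obtain ⟨b, rfl⟩ := Submodule.mem_span_singleton.1 hv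
      refine (Submodule.mem_span_range_iff_exists_fun ℂ).2 ⟨![a, b], ?_⟩
      simp
    have h3 := Submodule.finrank_mono h2
    rw [Submodule.finrank_map_subtype_eq] at h3
    have h4 := finrank_range_le_card (R := ℂ) ![((x, 0) : V × V), (0, x)]
    rw [Set.finrank, Fintype.card_fin] at h4
    omega
  obtain ⟨w', hw', s, t, hst, ⟨u, v⟩, huv, hf⟩ := exists_rank_one (U.map f) (by omega)
  obtain ⟨w, rfl⟩ := K.mkQ_surjective w'
  have h1 : K.mkQ (s • w - u) = 0 := by
    have : K.mkQ u = s • K.mkQ w := congrArg Prod.fst hf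
    rw [map_sub, map_smul, this, sub_self]
  have h2 : K.mkQ (t • w - v) = 0 := by
    have : K.mkQ v = t • K.mkQ w := congrArg Prod.snd hf
    rw [map_sub, map_smul, this, sub_self]
  rw [Submodule.mkQ_apply, Submodule.Quotient.mk_eq_zero] at h1 h2
  obtain ⟨a, ha⟩ := Submodule.mem_span_singleton.1 h1
  obtain ⟨b, hb⟩ := Submodule.mem_span_singleton.1 h2
  refine ⟨w, ?_, s, t, hst, ?_⟩
  · rw [LinearIndependent.pair_iff' hx0]
    rintro c rfl
    refine hw' ?_
    rw [Submodule.mkQ_apply, Submodule.Quotient.mk_eq_zero]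
    exact Submodule.smul_mem _ _ (Submodule.mem_span_singleton_self x)
  · refine mem_of_eq_comb huv hx hx' 1 a b ?_ ?_
    · rw [ha]; module
    · rw [hb]; module

/-- Modulo the span of `x` and `w`, a further element `(u, v)` is nonzero by conciseness and has a
direction in the line `V / ⟨x, w⟩`, tensored with `ℂ²`. A direction different from that of `w`
splits off by a shear; an equal one leaves `v` in the span of `x` and `w`, and its `w`-coefficient
decides between a Jordan block and two equal eigenvalues. -/
theorem hasColumns_of_tmul_le_aux (hV : Module.finrank ℂ V = 3) (hU : IsConciseSubspace U)
    {x w : V} (hxw : LinearIndependent ℂ ![x, w]) (hx : (x, 0) ∈ U) (hx' : (0, x) ∈ U)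
    (hw : (w, 0) ∈ U) :
    HasColumns U netL1J1J1 ∨ HasColumns U netL1J2 ∨ HasColumns U netL1J1J1' := by
  obtain ⟨ξ, hξ0, hξ⟩ := exists_dual_ne_zero hV x w
  obtain ⟨⟨u, v⟩, huv, h⟩ : ∃ y ∈ U, ξ y.1 ≠ 0 ∨ ξ y.2 ≠ 0 := by
    by_contra! hcon
    exact hξ0 (hU.eq_zero_of_forall ξ hcon)
  by_cases hv : ξ v = 0
  · have hu : LinearIndependent ℂ ![x, w, u] := by
      refine linearIndependent_triple_of_pair hxw ?_
      rintro a b rfl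
      exact h.elim (fun h => h (hξ a b)) (fun h => h hv)
    obtain ⟨a, b, c, hvv⟩ := exists_eq_of_linearIndependent_triple hV hu v
    have hc : c = 0 := by
      rw [hvv, map_add, hξ, zero_add, map_smul, smul_eq_mul, mul_eq_zero] at hv
      refine hv.resolve_right fun hu0 => ?_
      refine h.elim (fun h => h hu0) (fun h => h ?_)
      rw [hvv, map_add, hξ, map_smul, hu0, smul_zero, add_zero]
    subst hc
    have h0 := linearIndependent_triple_iff.1 hu
    by_cases hb : b = 0
    · refine Or.inl (HasColumns.of_linearIndependent hV hu 1 (by simp) fun k => ?_)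
      rw [pencilMap_one]
      fin_cases k <;> simp [netL1J1J1, Fin.sum_univ_three]
      exacts [hx, hx', hw, mem_of_eq_comb huv hx' hx' 1 (-a) 0 (by module)
        (by rw [hvv, hb]; module)]
    · refine Or.inr (Or.inl (HasColumns.of_linearIndependent hV (x := ![x, b • w, u]) ?_ 1 (by simp)
        fun k => ?_))
      · rw [linearIndependent_triple_iff]
        intro r s t hrst
        obtain ⟨h1, h2, h3⟩ := h0 r (s * b) t (by rw [← hrst]; module)
        exact ⟨h1, (mul_eq_zero.1 h2).resolve_right hb, h3⟩
      · rw [pencilMap_one]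
        fin_cases k <;> simp [netL1J2, Fin.sum_univ_three]
        exacts [hx, hx', mem_of_eq_comb hw hw hw b 0 0 (by module) (by module),
          mem_of_eq_comb huv hx' hx' 1 (-a) 0 (by module) (by rw [hvv]; module)]
  · have hv' : LinearIndependent ℂ ![x, w, v] := by
      refine linearIndependent_triple_of_pair hxw ?_
      rintro a b rfl
      exact hv (hξ a b)
    obtain ⟨a, b, c, huu⟩ := exists_eq_of_linearIndependent_triple hV hv' u
    refine Or.inr (Or.inr (HasColumns.of_linearIndependent hV hv' !![1, c; 0, 1] (by simp)
      fun k => ?_))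
    rw [pencilMap_apply]
    fin_cases k <;> simp [netL1J1J1', Fin.sum_univ_three]
    exacts [hx, mem_of_eq_comb hx hx' hx' c 1 0 (by module) (by module), hw,
      mem_of_eq_comb huv hx hw 1 (-a) (-b) (by rw [huu]; module) (by module)]

theorem hasColumns_of_tmul_le (hV : Module.finrank ℂ V = 3) (hU : IsConciseSubspace U)
    (hdim : Module.finrank ℂ U = 4) {x : V} (hx0 : x ≠ 0) (hx : (x, 0) ∈ U) (hx' : (0, x) ∈ U) :
    HasColumns U netL1J1J1 ∨ HasColumns U netL1J2 ∨ HasColumns U netL1J1J1' := by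
  obtain ⟨w, hxw, s, t, hst, hw⟩ := exists_rank_one_of_tmul_le hV hdim hx0 hx hx'
  obtain ⟨g, hg, rfl, rfl⟩ := exists_det_ne_zero hst
  have := hasColumns_of_tmul_le_aux hV (hU.comap hg) hxw
    (by
      rw [Submodule.mem_comap, pencilMap_apply]
      exact mem_of_eq_comb hx hx' hx' (g 0 0) (g 1 0) 0 (by module) (by module))
    (by
      rw [Submodule.mem_comap, pencilMap_apply]
      exact mem_of_eq_comb hx hx' hx' (g 0 1) (g 1 1) 0 (by module) (by module))
    (by simpa [pencilMap_apply] using hw)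
  exact this.imp (·.of_comap hg) (Or.imp (·.of_comap hg) (·.of_comap hg))

/-- By dimension `U` contains some `(0, q)`, and `q` is independent of `p, p'` since no `x ⊗ ℂ²`
lies in `U`. A fourth element reduces to `(c q, e p + f p')` with both components nonzero, which
links `(p, 0), (p', 0), (0, q)` into a chain; whichever of `p, p'` completes the basis is the
remaining vector. -/
theorem hasColumns_netL2J1_aux (hV : Module.finrank ℂ V = 3) (hdim : Module.finrank ℂ U = 4)
    (hno : ∀ x, (x, 0) ∈ U → (0, x) ∈ U → x = 0) {p p' : V}
    (hpp : LinearIndependent ℂ ![p, p']) (hp : (p, 0) ∈ U) (hp' : (p', 0) ∈ U) :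
    HasColumns U netL2J1 := by
  have : Module.Finite ℂ V := Module.finite_of_finrank_pos (by omega)
  obtain ⟨⟨q', q⟩, hq, hq0, hq'⟩ := exists_ne_zero_of_finrank_lt U (LinearMap.fst ℂ V V) (by omega)
  simp only [LinearMap.fst_apply] at hq'
  subst hq'
  have hind : LinearIndependent ℂ ![p, p', q] := by
    refine linearIndependent_triple_of_pair hpp ?_
    rintro a b rfl
    refine hq0 (Prod.ext rfl (hno _ ?_ hq))
    exact mem_of_eq_comb hp hp' hp a b 0 (by module) (by module)
  obtain ⟨⟨u, v⟩, huv, hnot⟩ := exists_notMem_of_finrank_lt U ![(p, 0), (p', 0), (0, q)] (by omega)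
  obtain ⟨a, b, c, rfl⟩ := exists_eq_of_linearIndependent_triple hV hind u
  obtain ⟨e, f, d, rfl⟩ := exists_eq_of_linearIndependent_triple hV hind v
  have hcq : (c • q, e • p + f • p') ∈ U := by
    have h1 : (c • q, e • p + f • p' + d • q) ∈ U :=
      mem_of_eq_comb huv hp hp' 1 (-a) (-b) (by module) (by module)
    exact mem_of_eq_comb h1 hq hq 1 (-d) 0 (by module) (by module)
  have hspan : ∀ r s t : ℂ, (r • p + s • p', t • q) ∈
      Submodule.span ℂ (Set.range ![((p, 0) : V × V), (p', 0), (0, q)]) := by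
    intro r s t
    refine (Submodule.mem_span_range_iff_exists_fun ℂ).2 ⟨![r, s, t], ?_⟩
    simp [Fin.sum_univ_three]
  have h0 := linearIndependent_triple_iff.1 hind
  have hq00 : q ≠ 0 := hind.ne_zero 2
  have hef : ¬(e = 0 ∧ f = 0) := by
    rintro ⟨rfl, rfl⟩
    by_cases hc : c = 0
    · subst hc
      refine hnot ?_
      simpa using hspan a b d
    · refine hq00 (hno q ?_ hq)
      exact mem_of_eq_comb hcq hcq hcq c⁻¹ 0 0
        (by rw [smul_smul, inv_mul_cancel₀ hc]; module) (by module)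
  have hc : c ≠ 0 := by
    rintro rfl
    have := hno (e • p + f • p') (mem_of_eq_comb hp hp' hp e f 0 (by module) (by module))
      (by simpa using hcq)
    obtain ⟨h1, h2, -⟩ := h0 e f 0 (by rw [← this]; module)
    exact hef ⟨h1, h2⟩
  have key : ∀ z, (z, 0) ∈ U → LinearIndependent ℂ ![e • p + f • p', c • q, z] →
      HasColumns U netL2J1 := by
    intro z hz hi
    refine HasColumns.of_linearIndependent hV hi 1 (by simp) fun k => ?_
    rw [pencilMap_one]
    fin_cases k <;> simp [netL2J1, Fin.sum_univ_three]
    exacts [mem_of_eq_comb hp hp' hp e f 0 (by module) (by module), hcq,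
      mem_of_eq_comb hq hq hq c 0 0 (by module) (by module), hz]
  by_cases he : e = 0
  · have hf : f ≠ 0 := fun hf => hef ⟨he, hf⟩
    refine key p hp (linearIndependent_triple_iff.2 fun r s t hrst => ?_)
    obtain ⟨h1, h2, h3⟩ := h0 (r * e + t) (r * f) (s * c) (by rw [← hrst]; module)
    rw [he, mul_zero, zero_add] at h1
    exact ⟨(mul_eq_zero.1 h2).resolve_right hf, (mul_eq_zero.1 h3).resolve_right hc, h1⟩
  · refine key p' hp' (linearIndependent_triple_iff.2 fun r s t hrst => ?_)
    obtain ⟨h1, h2, h3⟩ := h0 (r * e) (r * f + t) (s * c) (by rw [← hrst]; module)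
    have hr := (mul_eq_zero.1 h1).resolve_right he
    rw [hr, zero_mul, zero_add] at h2
    exact ⟨hr, (mul_eq_zero.1 h3).resolve_right hc, h2⟩

theorem hasColumns_netL2J1 (hV : Module.finrank ℂ V = 3) (hdim : Module.finrank ℂ U = 4)
    (hno : ∀ x, (x, 0) ∈ U → (0, x) ∈ U → x = 0) {p p' : V}
    (hpp : LinearIndependent ℂ ![p, p']) {s t : ℂ} (hst : s ≠ 0 ∨ t ≠ 0)
    (hp : (s • p, t • p) ∈ U) (hp' : (s • p', t • p') ∈ U) :
    HasColumns U netL2J1 := by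
  obtain ⟨g, hg, rfl, rfl⟩ := exists_det_ne_zero hst
  refine (hasColumns_netL2J1_aux (U := U.comap (pencilMap V g)) hV
    (by rw [finrank_comap_pencilMap hg, hdim]) ?_ hpp (by simpa [pencilMap_apply] using hp)
    (by simpa [pencilMap_apply] using hp')).of_comap hg
  intro x hx hx'
  simp only [Submodule.mem_comap, pencilMap_apply, smul_zero, add_zero, zero_add] at hx hx'
  rw [Matrix.det_fin_two] at hg
  have h1 : ((g 0 0 * g 1 1 - g 0 1 * g 1 0) • x, (0 : V)) ∈ U :=
    mem_of_eq_comb hx hx' hx (g 1 1) (-g 1 0) 0 (by module) (by module)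
  have h2 : ((0 : V), (g 0 0 * g 1 1 - g 0 1 * g 1 0) • x) ∈ U :=
    mem_of_eq_comb hx hx' hx (-g 0 1) (g 0 0) 0 (by module) (by module)
  exact (smul_eq_zero.1 (hno _ h1 h2)).resolve_left hg

/-- Without `x ⊗ ℂ²` in `U` and without two independent rank-one elements of a common direction, the
second projection is onto. Starting from `(x₀, 0)`, one lifts successively to a chain `(x₁, x₀),
(x₂, x₁), (x₃, x₂)`. It must span `V`, and a correction of the chain ends it with zero. -/
theorem hasColumns_of_finrank_eq_four (hV : Module.finrank ℂ V = 3) (hU : IsConciseSubspace U)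
    (hdim : Module.finrank ℂ U = 4) :
    HasColumns U netL1J1J1 ∨ HasColumns U netL1J2 ∨ HasColumns U netL1J1J1' ∨
      HasColumns U netL2J1 ∨ HasColumns U netL3 := by
  have : Module.Finite ℂ V := Module.finite_of_finrank_pos (by omega)
  by_cases hex : ∃ x, x ≠ 0 ∧ (x, 0) ∈ U ∧ (0, x) ∈ U
  · obtain ⟨x, hx0, hx, hx'⟩ := hex
    exact (hasColumns_of_tmul_le hV hU hdim hx0 hx hx').imp id (Or.imp id Or.inl)
  have hno : ∀ x, (x, 0) ∈ U → (0, x) ∈ U → x = 0 := by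
    intro x hx hx'
    by_contra hx0
    exact hex ⟨x, hx0, hx, hx'⟩
  by_cases hK : ∃ (p p' : V) (s t : ℂ), LinearIndependent ℂ ![p, p'] ∧ (s ≠ 0 ∨ t ≠ 0) ∧
      (s • p, t • p) ∈ U ∧ (s • p', t • p') ∈ U
  · obtain ⟨p, p', s, t, hpp, hst, hp, hp'⟩ := hK
    exact Or.inr (Or.inr (Or.inr (Or.inl (hasColumns_netL2J1 hV hdim hno hpp hst hp hp'))))
  -- Otherwise the second projection has a kernel of dimension at least two on `U`, giving two
  -- independent elements of direction `(1, 0)`.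
  have hsurj : ∀ y, ∃ x, (x, y) ∈ U := by
    by_contra hcon
    have : Module.Finite ℂ U := Module.finite_of_finrank_pos (by omega)
    let π : U →ₗ[ℂ] V := LinearMap.snd ℂ V V ∘ₗ U.subtype
    have hlt : LinearMap.range π < ⊤ := by
      rw [lt_top_iff_ne_top]
      intro htop
      refine hcon fun y => ?_
      obtain ⟨⟨⟨x, y'⟩, hx⟩, rfl⟩ := LinearMap.range_eq_top.1 htop y
      exact ⟨x, hx⟩
    have h1 := Submodule.finrank_lt hlt.ne
    have h2 := LinearMap.finrank_range_add_finrank_ker π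
    have h3 : 2 ≤ Module.finrank ℂ ((LinearMap.ker π).map U.subtype) := by
      rw [Submodule.finrank_map_subtype_eq]; omega
    obtain ⟨x, hx, hx0⟩ := exists_notMem_of_finrank_lt (n := 0) _ ![] (lt_of_lt_of_le two_pos h3)
    obtain ⟨y, hy, hyx⟩ := exists_notMem_of_finrank_lt _ ![x] (lt_of_lt_of_le one_lt_two h3)
    obtain ⟨⟨⟨p, z⟩, hp⟩, hz, rfl⟩ := hx
    obtain ⟨⟨⟨p', z'⟩, hp'⟩, hz', rfl⟩ := hy
    have hz0 : z = 0 := hz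
    have hz0' : z' = 0 := hz'
    subst hz0 hz0'
    have hp0 : p ≠ 0 := by
      rintro rfl
      exact hx0 (zero_mem _)
    refine hK ⟨p, p', 1, 0, ?_, Or.inl one_ne_zero, by simpa using hp, by simpa using hp'⟩
    rw [LinearIndependent.pair_iff' hp0]
    rintro c rfl
    refine hyx ?_
    have : ((c • p, 0) : V × V) = c • (p, 0) := by simp
    simp only [Submodule.subtype_apply, this]
    exact Submodule.smul_mem _ _ (Submodule.subset_span ⟨0, rfl⟩)
  obtain ⟨⟨x₀, z⟩, hx₀, hx₀0, hz⟩ :=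
    exists_ne_zero_of_finrank_lt U (LinearMap.snd ℂ V V) (by omega)
  simp only [LinearMap.snd_apply] at hz
  subst hz
  have hx₀0 : x₀ ≠ 0 := by
    rintro rfl
    exact hx₀0 rfl
  obtain ⟨x₁, hx₁⟩ := hsurj x₀
  obtain ⟨x₂, hx₂⟩ := hsurj x₁
  obtain ⟨x₃, hx₃⟩ := hsurj x₂
  have h01 : LinearIndependent ℂ ![x₀, x₁] := by
    rw [LinearIndependent.pair_iff' hx₀0]
    rintro c rfl
    exact hx₀0 (hno _ hx₀ (mem_of_eq_comb hx₁ hx₀ hx₀ 1 (-c) 0 (by module) (by module)))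
  by_cases h012 : LinearIndependent ℂ ![x₀, x₁, x₂]
  -- With `x₃ = a x₀ + b x₁ + c x₂`, subtracting the shifted chain with the same coefficients at
  -- every level keeps it a chain and makes its last first-component zero.
  · obtain ⟨a, b, c, rfl⟩ := exists_eq_of_linearIndependent_triple hV h012 x₃
    refine Or.inr (Or.inr (Or.inr (Or.inr (HasColumns.of_linearIndependent hV
      (x := ![x₀, x₁ - c • x₀, x₂ - c • x₁ - b • x₀]) ?_ 1 (by simp) fun k => ?_))))
    · rw [linearIndependent_triple_iff] at h012 ⊢
      intro r s t hrst
      obtain ⟨h1, h2, h3⟩ := h012 (r - s * c - t * b) (s - t * c) t (by rw [← hrst]; module)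
      subst h3
      have hs : s = 0 := by simpa using h2
      subst hs
      exact ⟨by simpa using h1, rfl, rfl⟩
    · rw [pencilMap_one]
      fin_cases k <;> simp [netL3, Fin.sum_univ_three]
      · exact hx₀
      · exact mem_of_eq_comb hx₁ hx₀ hx₀ 1 (-c) 0 (by module) (by module)
      · exact mem_of_eq_comb hx₂ hx₁ hx₀ 1 (-c) (-b) (by module) (by module)
      · refine mem_of_eq_comb (mem_of_eq_comb hx₃ hx₂ hx₁ 1 (-c) (-b) rfl rfl) hx₀ hx₀ 1 (-a) 0
          ?_ ?_ <;> module
  · obtain ⟨a, b, rfl⟩ := exists_eq_of_not_linearIndependent_triple h01 h012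
    obtain ⟨ξ, hξ0, hξ⟩ := exists_dual_ne_zero hV x₀ x₁
    obtain ⟨y, hy⟩ : ∃ y, ξ y ≠ 0 := by
      by_contra! hcon
      exact hξ0 (LinearMap.ext hcon)
    have hind : LinearIndependent ℂ ![x₀, x₁, y] := by
      refine linearIndependent_triple_of_pair h01 ?_
      rintro r s rfl
      exact hy (hξ r s)
    obtain ⟨z, hz⟩ := hsurj y
    obtain ⟨d, e, c, rfl⟩ := exists_eq_of_linearIndependent_triple hV hind z
    have hb : (b • x₁, x₁) ∈ U := mem_of_eq_comb hx₂ hx₀ hx₀ 1 (-a) 0 (by module) (by module)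
    -- The chain inside `⟨x₀, x₁⟩` yields a rank-one element of direction `(μ, 1)` for each `μ`.
    -- Taking for `μ` the coefficient `c` by which `y` is scaled modulo this plane gives a second,
    -- independent one, a contradiction.
    refine (hK ⟨x₁ + (c - b) • x₀, y - e • x₀, c, 1, ?_, Or.inr one_ne_zero, ?_, ?_⟩).elim
    · rw [LinearIndependent.pair_iff]
      intro r s hrs
      obtain ⟨-, h2, h3⟩ := linearIndependent_triple_iff.1 hind (r * (c - b) - s * e) r s
        (by rw [← hrs]; module)
      exact ⟨h2, h3⟩
    · exact mem_of_eq_comb hb hx₁ hx₀ 1 (c - b) (c * (c - b)) (by module) (by module)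
    · exact mem_of_eq_comb hz hx₁ hx₀ 1 (-e) (-d - c * e) (by module) (by module)

end FourDimensional

/-! ### Subspaces of dimension five and six -/

section FiveDimensional

variable {V : Type*} [AddCommGroup V] [Module ℂ V] {U : Submodule ℂ (V × V)}

theorem exists_dual_mem_iff (hV : Module.finrank ℂ V = 3) (hdim : Module.finrank ℂ U = 5) :
    ∃ α β : Module.Dual ℂ V, (α ≠ 0 ∨ β ≠ 0) ∧ ∀ x y, (x, y) ∈ U ↔ α x + β y = 0 := by
  have : Module.Finite ℂ V := Module.finite_of_finrank_pos (by omega)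
  have hVV : Module.finrank ℂ (V × V) = 6 := by rw [Module.finrank_prod, hV]
  have hlt : U < ⊤ := by
    rw [lt_top_iff_ne_top]
    rintro rfl
    rw [finrank_top, hVV] at hdim
    omega
  obtain ⟨Φ, hΦ0, hΦ⟩ := Submodule.exists_le_ker_of_lt_top _ hlt
  have hker : Module.finrank ℂ (LinearMap.ker Φ) = 5 := by
    have h1 := LinearMap.finrank_range_add_finrank_ker Φ
    rw [LinearMap.range_eq_top.2 (LinearMap.surjective_of_ne_zero hΦ0), finrank_top,
      Module.finrank_self, hVV] at h1
    omega
  have hUeq : U = LinearMap.ker Φ := Submodule.eq_of_le_of_finrank_eq hΦ (by rw [hdim, hker])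
  have hxy : ∀ x y, Φ (x, y) = (Φ ∘ₗ LinearMap.inl ℂ V V) x + (Φ ∘ₗ LinearMap.inr ℂ V V) y := by
    intro x y
    simp [← map_add]
  refine ⟨Φ ∘ₗ LinearMap.inl ℂ V V, Φ ∘ₗ LinearMap.inr ℂ V V, ?_, fun x y => ?_⟩
  · by_contra! hcon
    refine hΦ0 (LinearMap.ext fun ⟨x, y⟩ => ?_)
    rw [hxy, hcon.1, hcon.2]
    simp
  · rw [hUeq, LinearMap.mem_ker, hxy]

theorem hasColumns_netL1L1J1 (hV : Module.finrank ℂ V = 3) {β : Module.Dual ℂ V} (hβ : β ≠ 0)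
    (hU : ∀ x y, (x, y) ∈ U ↔ β y = 0) : HasColumns U netL1L1J1 := by
  have : Module.Finite ℂ V := Module.finite_of_finrank_pos (by omega)
  obtain ⟨y, hy⟩ : ∃ y, β y ≠ 0 := by
    by_contra! hcon
    exact hβ (LinearMap.ext hcon)
  have hker : Module.finrank ℂ (LinearMap.ker β) = 2 := by
    have h1 := LinearMap.finrank_range_add_finrank_ker β
    rw [LinearMap.range_eq_top.2 (LinearMap.surjective_of_ne_zero hβ), finrank_top,
      Module.finrank_self, hV] at h1
    omega
  let e := Module.finBasisOfFinrankEq ℂ (LinearMap.ker β) hker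
  have h0 : β (e 0) = 0 := (e 0).2
  have h1 : β (e 1) = 0 := (e 1).2
  have he : LinearIndependent ℂ ![(e 0 : V), (e 1 : V)] := by
    have h : ![(e 0 : V), (e 1 : V)] = (LinearMap.ker β).subtype ∘ e := by
      ext i; fin_cases i <;> rfl
    rw [h]
    exact e.linearIndependent.map' (LinearMap.ker β).subtype (Submodule.ker_subtype _)
  refine HasColumns.of_linearIndependent hV (x := ![(e 0 : V), (e 1 : V), y])
    (linearIndependent_triple_of_pair he ?_) 1 (by simp) fun k => ?_
  · rintro r s rfl
    simp [h0, h1] at hy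
  · rw [pencilMap_one]
    fin_cases k <;> simp [netL1L1J1, Fin.sum_univ_three, hU, h0, h1]

/-- The columns lie in `U` once `(α, β)` takes the values `(0, 0)`, `(0, -1)`, `(1, 0)` at the three
basis vectors; such vectors exist because `α` and `β` are independent. -/
theorem hasColumns_netL1L2 (hV : Module.finrank ℂ V = 3) {α β : Module.Dual ℂ V}
    (hαβ : LinearIndependent ℂ ![α, β]) (hU : ∀ x y, (x, y) ∈ U ↔ α x + β y = 0) :
    HasColumns U netL1L2 := by
  have : Module.Finite ℂ V := Module.finite_of_finrank_pos (by omega)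
  obtain ⟨y, hy⟩ : ∃ y, α y = 1 := LinearMap.surjective_of_ne_zero (hαβ.ne_zero 0) 1
  have hne : β - β y • α ≠ 0 := by
    intro h
    have := LinearIndependent.pair_iff.1 hαβ (-β y) 1 (by rw [← h]; module)
    exact one_ne_zero this.2
  obtain ⟨z, hz⟩ : ∃ z, (β - β y • α) z = -1 := LinearMap.surjective_of_ne_zero hne (-1)
  obtain ⟨w, -, hw0, hw⟩ := exists_ne_zero_of_finrank_lt (⊤ : Submodule ℂ V) (α.prod β)
    (by rw [finrank_top, hV, Module.finrank_prod, Module.finrank_self]; norm_num)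
  have hwα : α w = 0 := congrArg Prod.fst hw
  have hwβ : β w = 0 := congrArg Prod.snd hw
  simp only [LinearMap.sub_apply, LinearMap.smul_apply, smul_eq_mul] at hz
  have h1α : α (z - α z • y) = 0 := by simp [hy]
  have h1β : β (z - α z • y) = -1 := by
    simp only [map_sub, map_smul, smul_eq_mul]
    linear_combination hz
  have h2α : α (y + β y • (z - α z • y)) = 1 := by rw [map_add, map_smul, h1α, hy]; simp
  have h2β : β (y + β y • (z - α z • y)) = 0 := by rw [map_add, map_smul, h1β]; simp
  generalize y + β y • (z - α z • y) = x₂ at h2α h2β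
  generalize z - α z • y = x₁ at h1α h1β
  refine HasColumns.of_linearIndependent hV (x := ![w, x₁, x₂])
    (linearIndependent_triple_iff.2 fun r s t hrst => ?_) 1 (by simp) fun k => ?_
  · have ht : t = 0 := by simpa [hwα, h1α, h2α] using congrArg α hrst
    have hs : s = 0 := by simpa [hwβ, h1β, h2β] using congrArg β hrst
    subst ht hs
    simp only [zero_smul, add_zero, smul_eq_zero] at hrst
    exact ⟨hrst.resolve_right hw0, rfl, rfl⟩
  · rw [pencilMap_one]
    fin_cases k <;> simp [netL1L2, Fin.sum_univ_three, *]

/-- A hyperplane is the kernel of an element `(α, β)` of `V* ⊗ ℂ²`, so only its rank matters. In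
rank one a base change of `ℂ²` makes the first form vanish. -/
theorem hasColumns_of_finrank_eq_five (hV : Module.finrank ℂ V = 3)
    (hdim : Module.finrank ℂ U = 5) : HasColumns U netL1L1J1 ∨ HasColumns U netL1L2 := by
  obtain ⟨α, β, hne, hU⟩ := exists_dual_mem_iff hV hdim
  by_cases hαβ : LinearIndependent ℂ ![α, β]
  · exact Or.inr (hasColumns_netL1L2 hV hαβ hU)
  · rw [LinearIndependent.pair_iff] at hαβ
    push Not at hαβ
    obtain ⟨s, t, hst, hst0⟩ := hαβ
    have hst0' : s ≠ 0 ∨ t ≠ 0 := by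
      by_cases hs : s = 0
      · exact Or.inr (hst0 hs)
      · exact Or.inl hs
    obtain ⟨g, hg, rfl, rfl⟩ := exists_det_ne_zero hst0'
    have hmem : ∀ x y, (x, y) ∈ U.comap (pencilMap V g) ↔ (g 0 1 • α + g 1 1 • β) y = 0 := by
      intro x y
      have := LinearMap.congr_fun hst x
      simp only [LinearMap.add_apply, LinearMap.smul_apply, smul_eq_mul,
        LinearMap.zero_apply] at this
      rw [Submodule.mem_comap, pencilMap_apply, hU]
      simp only [map_add, map_smul, LinearMap.add_apply, LinearMap.smul_apply, smul_eq_mul]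
      rw [← add_zero (g 0 1 * α y + g 1 1 * β y), ← this]
      ring_nf
    refine Or.inl ((hasColumns_netL1L1J1 hV ?_ hmem).of_comap hg)
    intro h0
    rw [Matrix.det_fin_two] at hg
    have hα : (g 0 0 * g 1 1 - g 0 1 * g 1 0) • α = 0 := by
      have : (g 0 0 * g 1 1 - g 0 1 * g 1 0) • α =
        g 1 1 • (g 0 0 • α + g 1 0 • β) - g 1 0 • (g 0 1 • α + g 1 1 • β) := by module
      rw [this, hst, h0]; simp
    have hβ : (g 0 0 * g 1 1 - g 0 1 * g 1 0) • β = 0 := by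
      have : (g 0 0 * g 1 1 - g 0 1 * g 1 0) • β =
        g 0 0 • (g 0 1 • α + g 1 1 • β) - g 0 1 • (g 0 0 • α + g 1 0 • β) := by module
      rw [this, hst, h0]; simp
    exact hne.elim (fun h => h ((smul_eq_zero.1 hα).resolve_left hg))
      (fun h => h ((smul_eq_zero.1 hβ).resolve_left hg))

theorem hasColumns_of_finrank_eq_six (hV : Module.finrank ℂ V = 3)
    (hdim : Module.finrank ℂ U = 6) : HasColumns U netL1L1L1 := by
  have : Module.Finite ℂ V := Module.finite_of_finrank_pos (by omega)
  have htop : U = ⊤ :=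
    Submodule.eq_top_of_finrank_eq (by rw [hdim, Module.finrank_prod, hV])
  exact ⟨Module.finBasisOfFinrankEq ℂ V hV, 1, by simp, fun k => htop ▸ Submodule.mem_top⟩

end FiveDimensional

/-! ### Independence of the columns of the normal forms -/

section IndependentColumns

theorem netJ2J1_columns (r : Fin 3 → ℂ)
    (h : ∀ i j, ∑ k, r k * netJ2J1 (Pi.single i 1) j k = 0) : r = 0 := by
  simp [netJ2J1, Fin.forall_fin_succ, Fin.sum_univ_succ] at h
  ext k; fin_cases k <;> simp_all

theorem netJ1J1J1'_columns (r : Fin 3 → ℂ)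
    (h : ∀ i j, ∑ k, r k * netJ1J1J1' (Pi.single i 1) j k = 0) : r = 0 := by
  simp [netJ1J1J1', Fin.forall_fin_succ, Fin.sum_univ_succ] at h
  ext k; fin_cases k <;> simp_all

theorem netL1R1_columns (r : Fin 3 → ℂ)
    (h : ∀ i j, ∑ k, r k * netL1R1 (Pi.single i 1) j k = 0) : r = 0 := by
  simp [netL1R1, Fin.forall_fin_succ, Fin.sum_univ_succ] at h
  ext k; fin_cases k <;> simp_all

theorem netJ3_columns (r : Fin 3 → ℂ)
    (h : ∀ i j, ∑ k, r k * netJ3 (Pi.single i 1) j k = 0) : r = 0 := by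
  simp [netJ3, Fin.forall_fin_succ, Fin.sum_univ_succ] at h
  ext k; fin_cases k <;> simp_all

theorem netJ2J1'_columns (r : Fin 3 → ℂ)
    (h : ∀ i j, ∑ k, r k * netJ2J1' (Pi.single i 1) j k = 0) : r = 0 := by
  simp [netJ2J1', Fin.forall_fin_succ, Fin.sum_univ_succ] at h
  ext k; fin_cases k <;> simp_all

theorem netJ1J1'J1''_columns (r : Fin 3 → ℂ)
    (h : ∀ i j, ∑ k, r k * netJ1J1'J1'' (Pi.single i 1) j k = 0) : r = 0 := by
  simp [netJ1J1'J1'', Fin.forall_fin_succ, Fin.sum_univ_succ] at h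
  ext k; fin_cases k <;> simp_all

theorem netL1J1J1_columns (r : Fin 4 → ℂ)
    (h : ∀ i j, ∑ k, r k * netL1J1J1 (Pi.single i 1) j k = 0) : r = 0 := by
  simp [netL1J1J1, Fin.forall_fin_succ, Fin.sum_univ_succ] at h
  ext k; fin_cases k <;> simp_all

theorem netL1J2_columns (r : Fin 4 → ℂ)
    (h : ∀ i j, ∑ k, r k * netL1J2 (Pi.single i 1) j k = 0) : r = 0 := by
  simp [netL1J2, Fin.forall_fin_succ, Fin.sum_univ_succ] at h
  ext k; fin_cases k <;> simp_all

theorem netL1J1J1'_columns (r : Fin 4 → ℂ)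
    (h : ∀ i j, ∑ k, r k * netL1J1J1' (Pi.single i 1) j k = 0) : r = 0 := by
  simp [netL1J1J1', Fin.forall_fin_succ, Fin.sum_univ_succ] at h
  ext k; fin_cases k <;> simp_all

theorem netL2J1_columns (r : Fin 4 → ℂ)
    (h : ∀ i j, ∑ k, r k * netL2J1 (Pi.single i 1) j k = 0) : r = 0 := by
  simp [netL2J1, Fin.forall_fin_succ, Fin.sum_univ_succ] at h
  ext k; fin_cases k <;> simp_all

theorem netL3_columns (r : Fin 4 → ℂ)
    (h : ∀ i j, ∑ k, r k * netL3 (Pi.single i 1) j k = 0) : r = 0 := by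
  simp [netL3, Fin.forall_fin_succ, Fin.sum_univ_succ] at h
  ext k; fin_cases k <;> simp_all

theorem netL1L1J1_columns (r : Fin 5 → ℂ)
    (h : ∀ i j, ∑ k, r k * netL1L1J1 (Pi.single i 1) j k = 0) : r = 0 := by
  simp [netL1L1J1, Fin.forall_fin_succ, Fin.sum_univ_succ] at h
  ext k; fin_cases k <;> simp_all

theorem netL1L2_columns (r : Fin 5 → ℂ)
    (h : ∀ i j, ∑ k, r k * netL1L2 (Pi.single i 1) j k = 0) : r = 0 := by
  simp [netL1L2, Fin.forall_fin_succ, Fin.sum_univ_succ] at h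
  ext k; fin_cases k <;> simp_all

theorem netL1L1L1_columns (r : Fin 6 → ℂ)
    (h : ∀ i j, ∑ k, r k * netL1L1L1 (Pi.single i 1) j k = 0) : r = 0 := by
  simp [netL1L1L1, Fin.forall_fin_succ, Fin.sum_univ_succ] at h
  ext k; fin_cases k <;> simp_all

end IndependentColumns

/-! ### The fourteen normal forms exhaust the concise tensors -/

section Classification

variable {V₁ V₂ V₃ : Type*} [AddCommGroup V₁] [Module ℂ V₁] [AddCommGroup V₂] [Module ℂ V₂]
  [AddCommGroup V₃] [Module ℂ V₃]

/-- The classification of the concise tensors in `ℂ³ ⊗ ℂ² ⊗ ℂᵐ` with `m ≥ 3`, grouped by their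
second collineation variety. -/
theorem exists_normalForm (h₁ : Module.finrank ℂ V₁ = 3) (h₂ : Module.finrank ℂ V₂ = 2)
    (h₃ : 3 ≤ Module.finrank ℂ V₃) (T : V₁ ⊗[ℂ] (V₂ ⊗[ℂ] V₃)) (hT : IsConcise T) :
    (HasNormalForm T netJ2J1 ∨ HasNormalForm T netJ1J1J1') ∨
    (HasNormalForm T netL1R1 ∨ HasNormalForm T netJ3 ∨ HasNormalForm T netJ2J1' ∨
      HasNormalForm T netJ1J1'J1'' ∨ HasNormalForm T netL1J1J1) ∨
    HasNormalForm T netL1J2 ∨ HasNormalForm T netL1J1J1' ∨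
    (HasNormalForm T netL2J1 ∨ HasNormalForm T netL1L1J1) ∨
    (HasNormalForm T netL3 ∨ HasNormalForm T netL1L2 ∨ HasNormalForm T netL1L1L1) := by
  have : Module.Finite ℂ V₁ := Module.finite_of_finrank_pos (by omega)
  have : Module.Finite ℂ V₂ := Module.finite_of_finrank_pos (by omega)
  have : Module.Finite ℂ V₃ := Module.finite_of_finrank_pos (by omega)
  let b : Module.Basis (Fin 2) ℂ V₂ := Module.finBasisOfFinrankEq ℂ V₂ h₂
  have hinj := sliceMap_injective hT b
  have hU := isConciseSubspace_range_sliceMap hT b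
  have hdim : Module.finrank ℂ (LinearMap.range (sliceMap T b)) = Module.finrank ℂ V₃ := by
    rw [LinearMap.finrank_range_of_inj hinj, Subspace.dual_finrank_eq]
  have hle : Module.finrank ℂ V₃ ≤ 6 := by
    have := Submodule.finrank_le (LinearMap.range (sliceMap T b))
    rw [hdim, Module.finrank_prod, h₁] at this
    exact this
  obtain hm | hm | hm | hm : Module.finrank ℂ V₃ = 3 ∨ Module.finrank ℂ V₃ = 4 ∨
      Module.finrank ℂ V₃ = 5 ∨ Module.finrank ℂ V₃ = 6 := by omega
  · rcases hasColumns_of_finrank_eq_three h₁ hU (hdim.trans hm) with h | h | h | h | h | h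
    · exact .inl (.inl (h.hasNormalForm hm netJ2J1_columns))
    · exact .inl (.inr (h.hasNormalForm hm netJ1J1J1'_columns))
    · exact .inr (.inl (.inl (h.hasNormalForm hm netL1R1_columns)))
    · exact .inr (.inl (.inr (.inl (h.hasNormalForm hm netJ3_columns))))
    · exact .inr (.inl (.inr (.inr (.inl (h.hasNormalForm hm netJ2J1'_columns)))))
    · exact .inr (.inl (.inr (.inr (.inr (.inl (h.hasNormalForm hm netJ1J1'J1''_columns))))))
  · rcases hasColumns_of_finrank_eq_four h₁ hU (hdim.trans hm) with h | h | h | h | h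
    · exact .inr (.inl (.inr (.inr (.inr (.inr (h.hasNormalForm hm netL1J1J1_columns))))))
    · exact .inr (.inr (.inl (h.hasNormalForm hm netL1J2_columns)))
    · exact .inr (.inr (.inr (.inl (h.hasNormalForm hm netL1J1J1'_columns))))
    · exact .inr (.inr (.inr (.inr (.inl (.inl (h.hasNormalForm hm netL2J1_columns))))))
    · exact .inr (.inr (.inr (.inr (.inr (.inl (h.hasNormalForm hm netL3_columns))))))
  · rcases hasColumns_of_finrank_eq_five h₁ (hdim.trans hm) with h | h
    · exact .inr (.inr (.inr (.inr (.inl (.inr (h.hasNormalForm hm netL1L1J1_columns))))))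
    · exact .inr (.inr (.inr (.inr (.inr (.inr (.inl (h.hasNormalForm hm netL1L2_columns)))))))
  · exact .inr (.inr (.inr (.inr (.inr (.inr (.inr
      ((hasColumns_of_finrank_eq_six h₁ (hdim.trans hm)).hasNormalForm hm
        netL1L1L1_columns)))))))

end Classification

/-! ### Mutual exclusion of the six varieties -/

section Distinctness

variable {W : Type*} [AddCommGroup W] [Module ℂ W] {X : Set (ℙ ℂ W)}

/-- No set is a copy of two of the six varieties. -/
theorem isLinearCopy_exclusive (n : Fin 6) (P : Fin 6 → Prop)
    (hP : P = ![IsLinearCopy X projLine, IsLinearCopy X projPlane, IsLinearCopy X quadricCone,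
      IsLinearCopy X smoothQuadric, IsLinearCopy X cubicScroll, IsLinearCopy X veroneseSurface])
    (hn : P n) (k : Fin 6) (hk : P k) : n = k := by
  have hdim : ∀ j, P j → Module.finrank ℂ (Submodule.span ℂ (puncturedCone X)) =
      (![2, 3, 4, 4, 5, 6] : Fin 6 → ℕ) j := by
    subst hP
    intro j hj
    fin_cases j
    · exact (finrank_span_puncturedCone hj (span_puncturedCone_univ 2)).trans (by simp)
    · exact (finrank_span_puncturedCone hj (span_puncturedCone_univ 3)).trans (by simp)
    · exact (finrank_span_puncturedCone hj span_puncturedCone_quadricCone).trans (by simp)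
    · exact (finrank_span_puncturedCone hj span_puncturedCone_smoothQuadric).trans (by simp)
    · exact (finrank_span_puncturedCone hj span_puncturedCone_cubicScroll).trans (by simp)
    · exact (finrank_span_puncturedCone hj span_puncturedCone_veroneseSurface).trans (by simp)
  have h := (hdim n hn).symm.trans (hdim k hk)
  have h23 : ¬(P 2 ∧ P 3) := by
    subst hP
    exact fun h => not_isLinearCopy_quadricCone_smoothQuadric h.1 h.2
  by_contra hne
  -- The span dimensions leave only the two quadrics to be told apart.
  have : (n = 2 ∧ k = 3) ∨ (n = 3 ∧ k = 2) := by
    revert h hne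
    clear hdim hn hk h23
    revert n k
    decide
  rcases this with ⟨rfl, rfl⟩ | ⟨rfl, rfl⟩
  exacts [h23 ⟨hn, hk⟩, h23 ⟨hk, hn⟩]

end Distinctness

end

end Collineation


/-! ### The main theorem -/

open Collineation in
theorem mainTheorem4 {V₁ V₂ V₃ : Type*} [AddCommGroup V₁] [Module ℂ V₁]
    [AddCommGroup V₂] [Module ℂ V₂] [AddCommGroup V₃] [Module ℂ V₃]
    (h₁ : Module.finrank ℂ V₁ = 3) (h₂ : Module.finrank ℂ V₂ = 2)
    (h₃ : 3 ≤ Module.finrank ℂ V₃)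
    (T : V₁ ⊗[ℂ] (V₂ ⊗[ℂ] V₃)) (hT : IsConcise T) :
    (IsLinearCopy (collineationVariety 2 T) projLine ∨
      IsLinearCopy (collineationVariety 2 T) projPlane ∨
      IsLinearCopy (collineationVariety 2 T) quadricCone ∨
      IsLinearCopy (collineationVariety 2 T) smoothQuadric ∨
      IsLinearCopy (collineationVariety 2 T) cubicScroll ∨
      IsLinearCopy (collineationVariety 2 T) veroneseSurface) ∧
    (IsLinearCopy (collineationVariety 2 T) projLine ↔
      HasNormalForm T netJ2J1 ∨ HasNormalForm T netJ1J1J1') ∧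
    (IsLinearCopy (collineationVariety 2 T) projPlane ↔
      HasNormalForm T netL1R1 ∨ HasNormalForm T netJ3 ∨ HasNormalForm T netJ2J1' ∨
        HasNormalForm T netJ1J1'J1'' ∨ HasNormalForm T netL1J1J1) ∧
    (IsLinearCopy (collineationVariety 2 T) quadricCone ↔ HasNormalForm T netL1J2) ∧
    (IsLinearCopy (collineationVariety 2 T) smoothQuadric ↔ HasNormalForm T netL1J1J1') ∧
    (IsLinearCopy (collineationVariety 2 T) cubicScroll ↔
      HasNormalForm T netL2J1 ∨ HasNormalForm T netL1L1J1) ∧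
    (IsLinearCopy (collineationVariety 2 T) veroneseSurface ↔
      HasNormalForm T netL3 ∨ HasNormalForm T netL1L2 ∨ HasNormalForm T netL1L1L1) := by
  have excl := isLinearCopy_exclusive (X := collineationVariety 2 T) (P := _) (hP := rfl)
  have toLine : HasNormalForm T netJ2J1 ∨ HasNormalForm T netJ1J1J1' →
      IsLinearCopy (collineationVariety 2 T) projLine := by
    rintro (h | h)
    exacts [isLinearCopy_of_netJ2J1 h, isLinearCopy_of_netJ1J1J1' h]
  have toPlane : HasNormalForm T netL1R1 ∨ HasNormalForm T netJ3 ∨ HasNormalForm T netJ2J1' ∨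
      HasNormalForm T netJ1J1'J1'' ∨ HasNormalForm T netL1J1J1 →
      IsLinearCopy (collineationVariety 2 T) projPlane := by
    rintro (h | h | h | h | h)
    exacts [isLinearCopy_of_netL1R1 h, isLinearCopy_of_netJ3 h, isLinearCopy_of_netJ2J1' h,
      isLinearCopy_of_netJ1J1'J1'' h, isLinearCopy_of_netL1J1J1 h]
  have toScroll : HasNormalForm T netL2J1 ∨ HasNormalForm T netL1L1J1 →
      IsLinearCopy (collineationVariety 2 T) cubicScroll := by
    rintro (h | h)
    exacts [isLinearCopy_of_netL2J1 h, isLinearCopy_of_netL1L1J1 h]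
  have toVeronese : HasNormalForm T netL3 ∨ HasNormalForm T netL1L2 ∨ HasNormalForm T netL1L1L1 →
      IsLinearCopy (collineationVariety 2 T) veroneseSurface := by
    rintro (h | h | h)
    exacts [isLinearCopy_of_netL3 h, isLinearCopy_of_netL1L2 h, isLinearCopy_of_netL1L1L1 h]
  -- Each group of normal forms fixes the variety. The matching equivalence then holds outright, and
  -- the forward direction of every other one is refuted by `excl`, so the normal forms themselves
  -- never have to be distinguished.
  rcases exists_normalForm h₁ h₂ h₃ T hT with h | h | h | h | h | h
  · have c := toLine h
    exact ⟨.inl c,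
      ⟨fun _ => h, toLine⟩,
      ⟨fun e => absurd (excl 0 c 1 e) (by decide), toPlane⟩,
      ⟨fun e => absurd (excl 0 c 2 e) (by decide), isLinearCopy_of_netL1J2⟩,
      ⟨fun e => absurd (excl 0 c 3 e) (by decide), isLinearCopy_of_netL1J1J1'⟩,
      ⟨fun e => absurd (excl 0 c 4 e) (by decide), toScroll⟩,
      ⟨fun e => absurd (excl 0 c 5 e) (by decide), toVeronese⟩⟩
  · have c := toPlane h
    exact ⟨.inr (.inl c),
      ⟨fun e => absurd (excl 1 c 0 e) (by decide), toLine⟩,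
      ⟨fun _ => h, toPlane⟩,
      ⟨fun e => absurd (excl 1 c 2 e) (by decide), isLinearCopy_of_netL1J2⟩,
      ⟨fun e => absurd (excl 1 c 3 e) (by decide), isLinearCopy_of_netL1J1J1'⟩,
      ⟨fun e => absurd (excl 1 c 4 e) (by decide), toScroll⟩,
      ⟨fun e => absurd (excl 1 c 5 e) (by decide), toVeronese⟩⟩
  · have c := isLinearCopy_of_netL1J2 h
    exact ⟨.inr (.inr (.inl c)),
      ⟨fun e => absurd (excl 2 c 0 e) (by decide), toLine⟩,
      ⟨fun e => absurd (excl 2 c 1 e) (by decide), toPlane⟩,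
      ⟨fun _ => h, isLinearCopy_of_netL1J2⟩,
      ⟨fun e => absurd (excl 2 c 3 e) (by decide), isLinearCopy_of_netL1J1J1'⟩,
      ⟨fun e => absurd (excl 2 c 4 e) (by decide), toScroll⟩,
      ⟨fun e => absurd (excl 2 c 5 e) (by decide), toVeronese⟩⟩
  · have c := isLinearCopy_of_netL1J1J1' h
    exact ⟨.inr (.inr (.inr (.inl c))),
      ⟨fun e => absurd (excl 3 c 0 e) (by decide), toLine⟩,
      ⟨fun e => absurd (excl 3 c 1 e) (by decide), toPlane⟩,
      ⟨fun e => absurd (excl 3 c 2 e) (by decide), isLinearCopy_of_netL1J2⟩,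
      ⟨fun _ => h, isLinearCopy_of_netL1J1J1'⟩,
      ⟨fun e => absurd (excl 3 c 4 e) (by decide), toScroll⟩,
      ⟨fun e => absurd (excl 3 c 5 e) (by decide), toVeronese⟩⟩
  · have c := toScroll h
    exact ⟨.inr (.inr (.inr (.inr (.inl c)))),
      ⟨fun e => absurd (excl 4 c 0 e) (by decide), toLine⟩,
      ⟨fun e => absurd (excl 4 c 1 e) (by decide), toPlane⟩,
      ⟨fun e => absurd (excl 4 c 2 e) (by decide), isLinearCopy_of_netL1J2⟩,
      ⟨fun e => absurd (excl 4 c 3 e) (by decide), isLinearCopy_of_netL1J1J1'⟩,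
      ⟨fun _ => h, toScroll⟩,
      ⟨fun e => absurd (excl 4 c 5 e) (by decide), toVeronese⟩⟩
  · have c := toVeronese h
    exact ⟨.inr (.inr (.inr (.inr (.inr c)))),
      ⟨fun e => absurd (excl 5 c 0 e) (by decide), toLine⟩,
      ⟨fun e => absurd (excl 5 c 1 e) (by decide), toPlane⟩,
      ⟨fun e => absurd (excl 5 c 2 e) (by decide), isLinearCopy_of_netL1J2⟩,
      ⟨fun e => absurd (excl 5 c 3 e) (by decide), isLinearCopy_of_netL1J1J1'⟩,
      ⟨fun e => absurd (excl 5 c 4 e) (by decide), toScroll⟩,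
      ⟨fun _ => h, toVeronese⟩⟩
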